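/- \textbf{Setting.} A strict partition is a sequence of integers $\lambda=(\lambda_1>\lambda_2>\dots\geq 0)$ with finitely many nonzero terms and distinct nonzero parts; $\tilde\lambda=(\lambda_2,\lambda_3,\dots)$, and $\mu\subseteq\lambda$ means $\mu_i\le\lambda_i$ for all $i$. Put $\mathsf{SD}_\lambda=\{(i,i+j-1): 1\le j\le\lambda_i\}$ and, for a finite set of boxes $D$, $\mathrm{Int}(D)=\{(i,j)\in D: (i+1,j)\in D \text{ or } (i,j+1)\in D\}$. For strict partitions $\mu\subseteq\lambda$, let $\mathsf{ShSVT}_Q(\lambda/\!/\mu)$ be the set of maps $T$ assigning a finite set $T_{ij}\subset\frac12\mathbb{Z}_{>0}$ to each $(i,j)\in\mathsf{SD}_\lambda\setminus\mathrm{Int}(\mathsf{SD}_\mu)$ (with $T_{ij}=\varnothing$ for all other $(i,j)$), nonempty if $(i,j)\in\mathsf{SD}_\lambda\setminus\mathsf{SD}_\mu$, such that for all $(i,j)$: every element of $T_{ij}$ is $\le$ every element of $T_{i,j+1}$ and of $T_{i+1,j}$; $T_{ij}\cap T_{i,j+1}\subset\mathbb{Z}$; and $T_{ij}\cap T_{i+1,j}\subset\mathbb{Z}-\frac12$.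 Let $\mathsf{ShSVT}_P(\lambda/\!/\mu)$ be the subset of those $T$ with $T_{ii}\subset\mathbb{Z}$ for all $i$. With $|T|=\sum|T_{ij}|$ and $x^T=\prod_{(i,j)}\prod_{a\in T_{ij}}x_{\lceil a\rceil}$, define \[\overline{GP}_{\lambda/\!/\mu}=\sum_{T\in\mathsf{ShSVT}_P(\lambda/\!/\mu)}(-1)^{|T|-|\lambda|+|\mu|}x^T,\qquad \overline{GQ}_{\lambda/\!/\mu}=\sum_{T\in\mathsf{ShSVT}_Q(\lambda/\!/\mu)}(-1)^{|T|-|\lambda|+|\mu|}x^T\] in $\mathbb{R}[[x_1,x_2,\dots]]$, and set both equal to $0$ if $\mu\not\subseteq\lambda$. Write $\overline{GP}_n=\overline{GP}_{(n)/\!/\emptyset}$ and $\overline{GQ}_n=\overline{GQ}_{(n)/\!/\emptyset}$. Let $\overline\Gamma_P$ and $\overline\Gamma_Q$ be the $\mathbb{R}$-algebras generated by all $\overline{GP}_{\lambda/\!/\mu}$, respectively all $\overline{GQ}_{\lambda/\!/\mu}$ (they are also the linear spans of these series). Each $A\in\{\overline\Gamma_P,\overline\Gamma_Q\}$ carries the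 coproduct of symmetric functions, the unique algebra morphism $\Delta:A\to A\otimes A$ such that $\Delta(f)$ becomes $f(x_1,x_2,\dots,y_1,y_2,\dots)$ under $p\otimes q\mapsto p(x)q(y)$. A specialization of $A$ is an $\mathbb{R}$-algebra morphism $A\to\mathbb{R}$. The union of two specializations is $\rho_1\sqcup\rho_2=\nabla\circ(\rho_1\otimes\rho_2)\circ\Delta$, where $\nabla$ is the multiplication of $\mathbb{R}$. Let $\hat 1$ be the specialization $f\mapsto f(1,0,0,\dots)$; it is defined since $f(x,0,0,\dots)$ is a polynomial in $x$ for all $f\in A$. For a specialization $\varphi$ of $A$ let $\varphi^+=\hat 1\sqcup\varphi$. A specialization of $\overline\Gamma_P$ (respectively, $\overline\Gamma_Q$) is called positive if it is nonnegative on every $\overline{GP}_{\lambda/\!/\mu}$ (respectively, every $\overline{GQ}_{\lambda/\!/\mu}$). \textbf{Proposition.} The coproduct $\Delta$ exists and is unique on $\overline\Gamma_P$ and on $\overline\Gamma_Q$, and the following holds. If $\varphi$ is a specialization of $\overline\Gamma_P$, then \[\varphi^+(\overline{GP}_{\lambda/\!/\mu})=\varphi(\overline{GP}_{\tilde\lambda/\!/\mu})\]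 for all strict partitions $\lambda,\mu$. Consequently $\varphi^+(\overline{GP}_n)=1$ for all $n\ge1$, and $\varphi^+$ is positive if and only if $\varphi$ is positive. Moreover, whenever $\overline{GQ}_{\lambda/\!/\mu}$ belongs to $\overline\Gamma_P$, then so does $\overline{GQ}_{\tilde\lambda/\!/\mu}$ and $\varphi^+(\overline{GQ}_{\lambda/\!/\mu})=\varphi(\overline{GQ}_{\tilde\lambda/\!/\mu})$; in particular $\varphi^+(\overline{GQ}_n)=1$ for all $n\geq 1$ with $\overline{GQ}_n\in\overline\Gamma_P$. (In fact $\overline\Gamma_Q\subset\overline\Gamma_P$, so this applies to all $\lambda$, $\mu$, $n$.) If $\varphi$ is a specialization of $\overline\Gamma_Q$, then \[\varphi^+(\overline{GQ}_{\lambda/\!/\mu})=\varphi(\overline{GQ}_{\tilde\lambda/\!/\mu})\] for all strict partitions $\lambda,\mu$. Consequently $\varphi^+(\overline{GQ}_n)=1$ for all $n\ge1$, and $\varphi^+$ is positive if and only if $\varphi$ is positive. -/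

import Mathlib

open scoped TensorProduct

noncomputable section

namespace ShiftedK

/-! ### Strict partitions and shifted diagrams -/

/-- A strict partition `λ₁ > λ₂ > ⋯ ≥ 0` whose nonzero parts are distinct. The parts are indexed
from `0`, so `part i` is `λ_{i+1}`. -/
@[ext]
structure StrictPartition where
  part : ℕ → ℕ
  strict : ∀ ⦃i j : ℕ⦄, i < j → part j ≠ 0 → part j < part i
  finite : ∃ N, ∀ i, N ≤ i → part i = 0

namespace StrictPartition

/-- Containment `μ ⊆ λ`: `μ_i ≤ λ_i` for all `i`. -/
def Sub (μ l : StrictPartition) : Prop := ∀ i, μ.part i ≤ l.part i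

/-- The one-row partition `(n)`; for `n = 0` it is the empty partition. -/
def row (n : ℕ) : StrictPartition where
  part i := if i = 0 then n else 0
  strict := by
    intro i j hij hj
    have : j ≠ 0 := by omega
    simp [this] at hj
  finite := ⟨1, fun i hi => by simp [show i ≠ 0 by omega]⟩

/-- The empty partition. -/
def empty : StrictPartition := row 0

/-- `(λ₂, λ₃, …)`, obtained from `λ` by removing the first part; it is empty if `λ` has at most
one nonzero part. -/
def tail (l : StrictPartition) : StrictPartition where
  part i := l.part (i + 1)
  strict := fun i j hij hj => l.strict (by omega : i + 1 < j + 1) hj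
  finite := by
    obtain ⟨N, hN⟩ := l.finite
    exact ⟨N, fun i hi => hN _ (by omega)⟩

/-- The shifted diagram `{(i, i + j - 1) : 1 ≤ j ≤ λ_i}`, with rows and columns numbered
from `0`; see `mem_SD`. All its boxes lie in a square of side `λ₁`. -/
def SD (l : StrictPartition) : Finset (ℕ × ℕ) :=
  (Finset.range (l.part 0) ×ˢ Finset.range (l.part 0)).filter
    fun b => b.1 ≤ b.2 ∧ b.2 < b.1 + l.part b.1

theorem part_add_le (l : StrictPartition) (i : ℕ) (hi : l.part i ≠ 0) :
    i + l.part i ≤ l.part 0 := by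
  induction i with
  | zero => simp
  | succ k ih =>
    have h : l.part (k + 1) < l.part k := l.strict (Nat.lt_succ_self k) hi
    have := ih (by omega)
    omega

theorem mem_SD (l : StrictPartition) (i j : ℕ) :
    (i, j) ∈ l.SD ↔ i ≤ j ∧ j < i + l.part i := by
  simp only [SD, Finset.mem_filter, Finset.mem_product, Finset.mem_range]
  constructor
  · exact fun h => h.2
  · intro h
    have := l.part_add_le i (by omega)
    omega

end StrictPartition

open StrictPartition

/-- The interior of a set of boxes: those boxes whose neighbour below or to the right is also
in the set. -/
def interior (D : Finset (ℕ × ℕ)) : Finset (ℕ × ℕ) :=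
  D.filter fun b => (b.1 + 1, b.2) ∈ D ∨ (b.1, b.2 + 1) ∈ D

/-! ### Set-valued shifted tableaux

Entries are taken from the alphabet `1' < 1 < 2' < 2 < ⋯`, where `i' = i - 1/2`. It is encoded
by the natural numbers `0 < 1 < 2 < 3 < ⋯`: the number `k` stands for the half-integer
`(k + 1) / 2`. So `k` is an integer letter iff `k` is odd, a primed letter iff `k` is even, and
in both cases its ceiling is `k / 2 + 1` (natural division). -/

/-- A filling of the boxes by finite sets of letters (empty outside the shape). -/
abbrev Filling := ℕ × ℕ → Finset ℕ

/-- The set-valued shifted tableaux of type `Q` and shape `λ // μ`, for `μ ⊆ λ`. -/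
structure IsShSVTQ (l μ : StrictPartition) (T : Filling) : Prop where
  support : ∀ b, b ∉ l.SD \ interior μ.SD → T b = ∅
  nonempty : ∀ b, b ∈ l.SD \ μ.SD → (T b).Nonempty
  row_le : ∀ i j, ∀ p ∈ T (i, j), ∀ q ∈ T (i, j + 1), p ≤ q
  col_le : ∀ i j, ∀ p ∈ T (i, j), ∀ q ∈ T (i + 1, j), p ≤ q
  row_inter : ∀ i j, ∀ p ∈ T (i, j) ∩ T (i, j + 1), Odd p
  col_inter : ∀ i j, ∀ p ∈ T (i, j) ∩ T (i + 1, j), Even p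

/-- The set-valued shifted tableaux of type `P`: no primed letters on the main diagonal. -/
structure IsShSVTP (l μ : StrictPartition) (T : Filling) : Prop extends IsShSVTQ l μ T where
  diag : ∀ i, ∀ p ∈ T (i, i), Odd p

/-- `|T|`, the total number of letters of a tableau of shape `λ // μ`. -/
def size (l : StrictPartition) (T : Filling) : ℕ := ∑ b ∈ l.SD, (T b).card

/-- The exponent of `x^T`. The variable `x_{i+1}` has index `i`, so the letter `k` contributes
the variable with index `k / 2`. -/
def weight (l : StrictPartition) (T : Filling) : ℕ →₀ ℕ :=
  ∑ b ∈ l.SD, ∑ k ∈ T b, Finsupp.single (k / 2) 1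

open Classical in
/-- `∑ β^(|T| - |λ/μ|) x^T` over the tableaux `T` of shape `λ // μ` satisfying `good`, or `0`
when `μ ⊄ λ`. There are finitely many `T` with a given monomial `x^T`. -/
def tableauSeries (good : Filling → Prop) (β : ℝ) (l μ : StrictPartition) :
    MvPowerSeries ℕ ℝ := fun m =>
  if μ.Sub l then
    ∑ᶠ (T : Filling) (_ : good T ∧ weight l T = m), β ^ (size l T - (l.SD \ μ.SD).card)
  else 0

/-- The `K`-theoretic Schur `P`-function `GP^{(β)}_{λ // μ}`. -/
def GP (β : ℝ) (l μ : StrictPartition) : MvPowerSeries ℕ ℝ :=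
  tableauSeries (IsShSVTP l μ) β l μ

/-- The `K`-theoretic Schur `Q`-function `GQ^{(β)}_{λ // μ}`. -/
def GQ (β : ℝ) (l μ : StrictPartition) : MvPowerSeries ℕ ℝ :=
  tableauSeries (IsShSVTQ l μ) β l μ

/-- The functions `GP^{(-1)}_{λ // μ}`. -/
def GPbar (l μ : StrictPartition) : MvPowerSeries ℕ ℝ := GP (-1) l μ

/-- The functions `GQ^{(-1)}_{λ // μ}`. -/
def GQbar (l μ : StrictPartition) : MvPowerSeries ℕ ℝ := GQ (-1) l μ

/-- The set of all `GP^{(-1)}_{λ // μ}`. -/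
def setGPbar : Set (MvPowerSeries ℕ ℝ) := {f | ∃ l μ, f = GPbar l μ}

/-- The set of all `GQ^{(-1)}_{λ // μ}`. -/
def setGQbar : Set (MvPowerSeries ℕ ℝ) := {f | ∃ l μ, f = GQbar l μ}

/-- The real algebra generated by all `GP^{(-1)}_{λ // μ}` (which is also their linear span). -/
def GammaP : Subalgebra ℝ (MvPowerSeries ℕ ℝ) := Algebra.adjoin ℝ setGPbar

/-- The real algebra generated by all `GQ^{(-1)}_{λ // μ}` (which is also their linear span). -/
def GammaQ : Subalgebra ℝ (MvPowerSeries ℕ ℝ) := Algebra.adjoin ℝ setGQbar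

theorem GPbar_mem (l μ : StrictPartition) : GPbar l μ ∈ GammaP :=
  Algebra.subset_adjoin ⟨l, μ, rfl⟩

theorem GQbar_mem (l μ : StrictPartition) : GQbar l μ ∈ GammaQ :=
  Algebra.subset_adjoin ⟨l, μ, rfl⟩

/-- `GP^{(-1)}_{λ // μ}` as an element of `GammaP`. -/
def gp (l μ : StrictPartition) : GammaP := ⟨GPbar l μ, GPbar_mem l μ⟩

/-- `GQ^{(-1)}_{λ // μ}` as an element of `GammaQ`. -/
def gq (l μ : StrictPartition) : GammaQ := ⟨GQbar l μ, GQbar_mem l μ⟩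

/-! ### Specializations, coproduct and union -/

/-- A specialization of `A`, that is, an algebra morphism `A → ℝ`, is positive relative to `S` if
it is nonnegative on every element of `S`. -/
def IsPositive {A : Subalgebra ℝ (MvPowerSeries ℕ ℝ)} (S : Set (MvPowerSeries ℕ ℝ))
    (φ : A →ₐ[ℝ] ℝ) : Prop :=
  ∀ f : A, (f : MvPowerSeries ℕ ℝ) ∈ S → 0 ≤ φ f

/-- The coefficient of `x^a y^b` in the power series in two sets of variables that an element of
`A ⊗ A` defines through `p ⊗ q ↦ p(x) q(y)`. -/
def pairCoeff (A : Subalgebra ℝ (MvPowerSeries ℕ ℝ)) (a b : ℕ →₀ ℕ) : A ⊗[ℝ] A →ₗ[ℝ] ℝ :=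
  LinearMap.mul' ℝ ℝ ∘ₗ
    TensorProduct.map (MvPowerSeries.coeff a ∘ₗ A.val.toLinearMap)
      (MvPowerSeries.coeff b ∘ₗ A.val.toLinearMap)

/-- `Δ` is the coproduct of symmetric functions on `A`: `Δ f` is `f(x₁, x₂, …, y₁, y₂, …)`.
In coefficients: if only the first `N` of the `x`-variables occur in `x^a`, then the coefficient
of `x^a y^b` in `Δ f` is the one in `f(x₁, …, x_N, y₁, y₂, …)`, where the variables
`y₁, y₂, …` are substituted for `x_{N+1}, x_{N+2}, …`. As `p ⊗ q ↦ p(x) q(y)` is injective,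
at most one `Δ` has this property. -/
def IsCoproduct (A : Subalgebra ℝ (MvPowerSeries ℕ ℝ)) (Δ : A →ₐ[ℝ] A ⊗[ℝ] A) : Prop :=
  ∀ (f : A) (N : ℕ) (a b : ℕ →₀ ℕ), (∀ i ∈ a.support, i < N) →
    pairCoeff A a b (Δ f) =
      MvPowerSeries.coeff (a + b.mapDomain (fun i => i + N)) (f : MvPowerSeries ℕ ℝ)

open Classical in
/-- The coproduct of `A`; a meaningless value if `A` is not closed under the coproduct. -/
def coproduct (A : Subalgebra ℝ (MvPowerSeries ℕ ℝ)) : A →ₐ[ℝ] A ⊗[ℝ] A :=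
  if h : ∃ Δ : A →ₐ[ℝ] A ⊗[ℝ] A, IsCoproduct A Δ then h.choose
  else Algebra.TensorProduct.includeLeft

/-- The union `ρ₁ ⊔ ρ₂ = ∇ ∘ (ρ₁ ⊗ ρ₂) ∘ Δ` of two specializations. -/
def union {A : Subalgebra ℝ (MvPowerSeries ℕ ℝ)} (ρ₁ ρ₂ : A →ₐ[ℝ] ℝ) : A →ₐ[ℝ] ℝ :=
  ((Algebra.TensorProduct.lmul' ℝ (S := ℝ)).comp (Algebra.TensorProduct.map ρ₁ ρ₂)).comp
    (coproduct A)

/-! ### The specialization `f ↦ f(1, 0, 0, …)` -/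

/-- The coefficient of `x^n` in the one-variable series `f(x) = f(x, 0, 0, …)`. -/
def coeffOne (n : ℕ) (f : MvPowerSeries ℕ ℝ) : ℝ := MvPowerSeries.coeff (Finsupp.single 0 n) f

theorem coeffOne_mul (n : ℕ) (f g : MvPowerSeries ℕ ℝ) :
    coeffOne n (f * g) = ∑ p ∈ Finset.HasAntidiagonal.antidiagonal n, coeffOne p.1 f * coeffOne p.2 g := by
  classical
  simp only [coeffOne, MvPowerSeries.coeff_mul]
  rw [Finsupp.antidiagonal_single, Finset.sum_map]
  rfl

/-- `f(x, 0, 0, …)` is the polynomial `p(x)`. -/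
def RestrictsTo (f : MvPowerSeries ℕ ℝ) (p : Polynomial ℝ) : Prop :=
  ∀ n, coeffOne n f = p.coeff n

theorem RestrictsTo.mul {f g : MvPowerSeries ℕ ℝ} {p q : Polynomial ℝ}
    (hf : RestrictsTo f p) (hg : RestrictsTo g q) : RestrictsTo (f * g) (p * q) := by
  intro n
  rw [coeffOne_mul, Polynomial.coeff_mul]
  exact Finset.sum_congr rfl fun x _ => by rw [hf, hg]

theorem RestrictsTo.add {f g : MvPowerSeries ℕ ℝ} {p q : Polynomial ℝ}
    (hf : RestrictsTo f p) (hg : RestrictsTo g q) : RestrictsTo (f + g) (p + q) := by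
  intro n
  rw [Polynomial.coeff_add, ← hf, ← hg]
  simp [coeffOne]

theorem restrictsTo_algebraMap (r : ℝ) :
    RestrictsTo (algebraMap ℝ (MvPowerSeries ℕ ℝ) r) (Polynomial.C r) := by
  classical
  intro n
  rw [Polynomial.coeff_C, coeffOne, MvPowerSeries.algebraMap_apply, Algebra.algebraMap_self,
    RingHom.id_apply, MvPowerSeries.coeff_C]
  simp [Finsupp.single_eq_zero]

/-- The algebra of those `f` for which `f(x, 0, 0, …)` is a polynomial in `x`. -/
def polyOne : Subalgebra ℝ (MvPowerSeries ℕ ℝ) where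
  carrier := {f | ∃ p, RestrictsTo f p}
  mul_mem' := fun ⟨p, hp⟩ ⟨q, hq⟩ => ⟨p * q, hp.mul hq⟩
  add_mem' := fun ⟨p, hp⟩ ⟨q, hq⟩ => ⟨p + q, hp.add hq⟩
  algebraMap_mem' := fun r => ⟨_, restrictsTo_algebraMap r⟩

/-- The value `f(1) = f(1, 0, 0, …)`, the sum of the coefficients of `f(x, 0, 0, …)`. -/
def valOne (f : MvPowerSeries ℕ ℝ) : ℝ := ∑ᶠ n, coeffOne n f

theorem RestrictsTo.valOne_eq {f : MvPowerSeries ℕ ℝ} {p : Polynomial ℝ}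
    (hf : RestrictsTo f p) : valOne f = p.eval 1 := by
  rw [valOne, finsum_congr hf, Polynomial.eval_eq_sum, Polynomial.sum,
    finsum_eq_sum_of_support_subset (s := p.support)]
  · simp
  · intro n hn
    simpa using hn

/-- If `f(x, 0, 0, …)` is a polynomial for all `f` in `A`, then `f ↦ f(1, 0, 0, …)` is a
specialization of `A`. -/
def evalOne (A : Subalgebra ℝ (MvPowerSeries ℕ ℝ)) (hA : A ≤ polyOne) : A →ₐ[ℝ] ℝ where
  toFun f := valOne f
  map_one' := by
    have h := restrictsTo_algebraMap 1
    rw [map_one] at h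
    simp [h.valOne_eq]
  map_mul' f g := by
    obtain ⟨p, hp⟩ := hA f.2
    obtain ⟨q, hq⟩ := hA g.2
    simp [hp.valOne_eq, hq.valOne_eq, (hp.mul hq).valOne_eq]
  map_zero' := by
    have h := restrictsTo_algebraMap 0
    rw [map_zero] at h
    simp [h.valOne_eq]
  map_add' f g := by
    obtain ⟨p, hp⟩ := hA f.2
    obtain ⟨q, hq⟩ := hA g.2
    simp [hp.valOne_eq, hq.valOne_eq, (hp.add hq).valOne_eq]
  commutes' r := by
    simp [(restrictsTo_algebraMap r).valOne_eq]

theorem tableauSeries_mem_polyOne (good : Filling → Prop) (β : ℝ) (l μ : StrictPartition) :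
    tableauSeries good β l μ ∈ polyOne := by
  classical
  have key : ∀ n, 2 * l.SD.card < n → coeffOne n (tableauSeries good β l μ) = 0 := by
    intro n hn
    change tableauSeries good β l μ (Finsupp.single 0 n) = 0
    rw [tableauSeries]
    split_ifs with h
    swap
    · rfl
    have hT : ∀ T : Filling, ¬ (good T ∧ weight l T = Finsupp.single 0 n) := by
      rintro T ⟨-, hw⟩
      have hval : ∀ i, (∑ b ∈ l.SD, ∑ k ∈ T b, if k / 2 = i then 1 else 0)
          = Finsupp.single 0 n i := by
        intro i
        rw [← hw, weight]
        simp [Finsupp.finsetSum_apply, Finsupp.single_apply]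
      have h0 := hval 0
      rw [Finsupp.single_eq_same] at h0
      have hle : (∑ b ∈ l.SD, ∑ k ∈ T b, if k / 2 = 0 then 1 else 0) ≤ ∑ b ∈ l.SD, 2 := by
        refine Finset.sum_le_sum fun b _ => ?_
        rw [← Finset.card_filter]
        calc ((T b).filter fun k => k / 2 = 0).card ≤ (Finset.range 2).card := by
              refine Finset.card_le_card fun k hk => ?_
              have := (Finset.mem_filter.1 hk).2
              exact Finset.mem_range.2 (by omega)
          _ = 2 := by simp
      rw [Finset.sum_const, smul_eq_mul] at hle
      omega
    simp [hT]
  refine ⟨∑ n ∈ Finset.range (2 * l.SD.card + 1),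
    Polynomial.monomial n (coeffOne n (tableauSeries good β l μ)), fun n => ?_⟩
  rw [Polynomial.finsetSum_coeff]
  simp only [Polynomial.coeff_monomial, Finset.sum_ite_eq', Finset.mem_range]
  split_ifs with h
  · rfl
  · exact key n (by omega)

theorem GammaP_le : GammaP ≤ polyOne :=
  Algebra.adjoin_le (by rintro _ ⟨l, μ, rfl⟩; exact tableauSeries_mem_polyOne _ _ _ _)

theorem GammaQ_le : GammaQ ≤ polyOne :=
  Algebra.adjoin_le (by rintro _ ⟨l, μ, rfl⟩; exact tableauSeries_mem_polyOne _ _ _ _)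

/-- The specialization `f ↦ f(1, 0, 0, …)` of `GammaP`. -/
def oneHatP : GammaP →ₐ[ℝ] ℝ := evalOne GammaP GammaP_le

/-- The specialization `f ↦ f(1, 0, 0, …)` of `GammaQ`. -/
def oneHatQ : GammaQ →ₐ[ℝ] ℝ := evalOne GammaQ GammaQ_le

/-- `φ⁺`, the union of `f ↦ f(1, 0, 0, …)` and `φ`, for a specialization `φ` of `GammaP`. -/
def plusP (φ : GammaP →ₐ[ℝ] ℝ) : GammaP →ₐ[ℝ] ℝ := union oneHatP φ

/-- `φ⁺`, the union of `f ↦ f(1, 0, 0, …)` and `φ`, for a specialization `φ` of `GammaQ`. -/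
def plusQ (φ : GammaQ →ₐ[ℝ] ℝ) : GammaQ →ₐ[ℝ] ℝ := union oneHatQ φ

end ShiftedK

end

/-!
For each type (`P` and `Q`) the argument rests on one bijection: cutting a tableau of shape
`λ // μ` at a letter `M` gives a tableau of shape `ν // μ` with letters `< M` and one of shape
`λ // ν` with letters `≥ M`, where `ν` consists of `μ` and the boxes with a letter `< M`
(`sum_cut`). No symmetry of the series is needed.

*Coproduct.* Cutting between the letters of `x_N` and of `x_{N+1}` gives
`G_{λ // μ}(x, y) = ∑_ν G_{ν // μ}(x) G_{λ // ν}(y)` for every `N` at once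
(`coeff_add_tabSeries`). So each generator has a coproduct in `A ⊗ A`. The elements having one form
a subalgebra, and since `p ⊗ q ↦ p(x) q(y)` is injective (`eq_of_pairCoeff_eq`), these coproducts
assemble to a unique algebra morphism (`existsUnique_isCoproduct`).

*Substitution of `1`.* By definition of the union, `φ⁺(f)` is `φ` applied to `f(1, x₁, x₂, …)`,
which therefore lies in `A` (`exists_union_evalOne`). It remains to show
`G_{λ // μ}(1, x₁, x₂, …) = G_{(λ₂, λ₃, …) // μ}` (`substOne_tabSeries`), in two steps.

First, `G_{ν // μ}(1, 0, 0, …)` is `1` if `(ν₂, ν₃, …) = μ`, and `0` otherwise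
(`finsum_coeff_tabSeries`). Here only the letters `1'` and `1` occur, and cutting between them
leaves a vertical strip `ρ // μ` of letters `1'` and a horizontal strip `ν // ρ` of letters `1`.
Signs cancel as soon as a corner of the inner shape can be filled and emptied freely. What survives
is one pair of strips, in which `ρ` has one box more than `μ` in each nonempty row of `μ`
(`strip_rigidity`).

Second, `∑_k G_{λ // (k, μ₁, μ₂, …)} = G_{(λ₂, λ₃, …) // μ}` (`sum_coeff_tabSeries_of_tail`). The
last box of the first row of `(k, μ)` is a corner unless `k` is minimal. Hence
`G_{λ // (k, μ)} = E_k - E_{k-1}`, where `E_k` is the signed sum over the tableaux of this shape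
that avoid the first row of `(k, μ)`. The sum telescopes to the term `E_k` with `k = λ₁`, in which
the first row of `λ` is empty.

The statements on positivity follow, since every strict partition is `(λ₂, λ₃, …)` for some `λ`.
-/

noncomputable section

namespace ShiftedK

open StrictPartition

/-! ### Shifted diagrams -/

namespace StrictPartition

theorem sub_iff_SD_subset {μ l : StrictPartition} : μ.Sub l ↔ μ.SD ⊆ l.SD := by
  constructor
  · rintro h ⟨i, j⟩ hb
    rw [mem_SD] at hb ⊢
    have := h i
    omega
  · intro h i
    by_contra hlt
    have hb : (i, i + l.part i) ∈ μ.SD := by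
      rw [mem_SD]
      omega
    have := (mem_SD _ _ _).1 (h hb)
    omega

theorem SD_injective : Function.Injective SD := by
  intro l μ h
  have h₁ := sub_iff_SD_subset.2 h.le
  have h₂ := sub_iff_SD_subset.2 h.ge
  ext i
  exact le_antisymm (h₁ i) (h₂ i)

theorem Sub.refl (l : StrictPartition) : l.Sub l := fun _ => le_rfl

theorem Sub.trans {l μ ν : StrictPartition} (h : l.Sub μ) (h' : μ.Sub ν) : l.Sub ν :=
  fun i => (h i).trans (h' i)

theorem part_succ_lt (l : StrictPartition) {i : ℕ} (h : l.part (i + 1) ≠ 0) :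
    l.part (i + 1) < l.part i :=
  l.strict (Nat.lt_succ_self i) h

theorem tail_sub (l : StrictPartition) : l.tail.Sub l := by
  intro i
  by_cases h : l.part (i + 1) = 0
  · simp [tail, h]
  · exact (l.part_succ_lt h).le

/-- The strict partition with parts `p 0, p 1, …`. Strictness only has to be checked for
consecutive parts. -/
def ofSucc (p : ℕ → ℕ) (hs : ∀ i, p (i + 1) ≠ 0 → p (i + 1) < p i)
    (hf : ∃ N, ∀ i, N ≤ i → p i = 0) : StrictPartition where
  part := p
  strict := by
    intro i j hij
    induction j, hij using Nat.le_induction with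
    | base => exact hs i
    | succ j _ ih =>
      intro hj
      have h₁ := hs j hj
      have h₂ := ih (by omega)
      omega
  finite := hf

/-- A finite set of boxes on or above the diagonal that contains with each box its left
and its upper neighbour is a shifted diagram. -/
theorem exists_SD_eq (D : Finset (ℕ × ℕ)) (hdiag : ∀ i j, (i, j) ∈ D → i ≤ j)
    (hleft : ∀ i j, i ≤ j → (i, j + 1) ∈ D → (i, j) ∈ D)
    (hup : ∀ i j, (i + 1, j) ∈ D → (i, j) ∈ D) : ∃ ν : StrictPartition, ν.SD = D := by
  classical
  obtain ⟨N, hN⟩ : ∃ N, ∀ b ∈ D, b.1 < N ∧ b.2 < N := by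
    refine ⟨D.sup (fun b => b.1 + b.2) + 1, fun b hb => ?_⟩
    have : b.1 + b.2 ≤ D.sup (fun b => b.1 + b.2) :=
      Finset.le_sup (f := fun b : ℕ × ℕ => b.1 + b.2) hb
    omega
  have hex : ∀ i, ∃ n, (i, i + n) ∉ D := fun i => ⟨N, fun h => by have := hN _ h; simp at this⟩
  have hmem : ∀ i n, (i, i + n) ∈ D ↔ n < Nat.find (hex i) := by
    intro i n
    refine ⟨fun h => ?_, fun h => by simpa using Nat.find_min (hex i) h⟩
    by_contra hn
    have hdown : ∀ k, (i, i + (Nat.find (hex i) + k)) ∈ D → (i, i + Nat.find (hex i)) ∈ D := by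
      intro k
      induction k with
      | zero => exact id
      | succ k ih => exact fun h => ih (hleft _ _ (by omega) h)
    refine Nat.find_spec (hex i) (hdown (n - Nat.find (hex i)) ?_)
    rwa [Nat.add_sub_cancel' (by omega)]
  refine ⟨ofSucc (fun i => Nat.find (hex i)) (fun i hi => ?_) ⟨N, fun i hi => ?_⟩, ?_⟩
  · have h₁ := (hmem (i + 1) (Nat.find (hex (i + 1)) - 1)).2 (by omega)
    have h₂ := hup _ _ h₁
    rw [show i + 1 + (Nat.find (hex (i + 1)) - 1) = i + Nat.find (hex (i + 1)) by omega] at h₂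
    exact (hmem _ _).1 h₂
  · by_contra h
    have := hN _ ((hmem i 0).2 (by omega))
    simp at this
    omega
  · ext ⟨i, j⟩
    rw [mem_SD]
    constructor
    · rintro ⟨h₁, h₂⟩
      have := (hmem i (j - i)).2 (by simp only [ofSucc] at h₂; omega)
      rwa [Nat.add_sub_cancel' h₁] at this
    · intro h
      have h₁ := hdiag _ _ h
      have := (hmem i (j - i)).1 (by rwa [Nat.add_sub_cancel' h₁])
      simp only [ofSucc]
      omega

theorem finite_sub (l : StrictPartition) : {ν : StrictPartition | ν.Sub l}.Finite := by
  refine Set.Finite.of_finite_image (f := SD) ((l.SD.powerset.finite_toSet).subset ?_)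
    SD_injective.injOn
  rintro _ ⟨ν, hν, rfl⟩
  simpa using sub_iff_SD_subset.1 hν

theorem finite_between (μ l : StrictPartition) :
    {ν : StrictPartition | μ.Sub ν ∧ ν.Sub l}.Finite := by
  refine l.finite_sub.subset ?_
  rintro ν ⟨-, h⟩
  exact h

/-- The finite set of all strict partitions `ν` with `μ ⊆ ν ⊆ λ`. -/
def between (μ l : StrictPartition) : Finset StrictPartition := (finite_between μ l).toFinset

@[simp]
theorem mem_between {μ l ν : StrictPartition} : ν ∈ between μ l ↔ μ.Sub ν ∧ ν.Sub l := by
  simp [between]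

end StrictPartition

theorem mem_interior_SD (l : StrictPartition) (i j : ℕ) :
    (i, j) ∈ interior l.SD ↔
      (i, j) ∈ l.SD ∧ ((i + 1, j) ∈ l.SD ∨ (i, j + 1) ∈ l.SD) := by
  simp [interior]

theorem interior_mono {D E : Finset (ℕ × ℕ)} (h : D ⊆ E) : interior D ⊆ interior E := by
  intro b hb
  simp only [interior, Finset.mem_filter] at hb ⊢
  exact ⟨h hb.1, hb.2.imp (@h _) (@h _)⟩

theorem interior_subset (D : Finset (ℕ × ℕ)) : interior D ⊆ D := Finset.filter_subset _ _

/-! ### Tableaux with bounded letters -/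

/-- The set-valued shifted tableaux of type `P` if `d` holds, and of type `Q` otherwise. -/
structure IsTab (d : Prop) (l μ : StrictPartition) (T : Filling) : Prop
    extends IsShSVTQ l μ T where
  diag : d → ∀ i, ∀ p ∈ T (i, i), Odd p

theorem isTab_true {l μ : StrictPartition} {T : Filling} :
    IsTab True l μ T ↔ IsShSVTP l μ T :=
  ⟨fun h => ⟨h.toIsShSVTQ, h.diag trivial⟩, fun h => ⟨h.toIsShSVTQ, fun _ => h.diag⟩⟩

theorem isTab_false {l μ : StrictPartition} {T : Filling} :
    IsTab False l μ T ↔ IsShSVTQ l μ T :=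
  ⟨fun h => h.toIsShSVTQ, fun h => ⟨h, False.elim⟩⟩

variable {d : Prop} {l μ ν : StrictPartition} {T : Filling}

theorem IsShSVTQ.mem_SD (hT : IsShSVTQ l μ T) {b : ℕ × ℕ} {k : ℕ} (hk : k ∈ T b) : b ∈ l.SD := by
  by_contra h
  rw [hT.support b fun hb => h (Finset.sdiff_subset hb)] at hk
  simp at hk

theorem IsShSVTQ.notMem_interior (hT : IsShSVTQ l μ T) {b : ℕ × ℕ} {k : ℕ} (hk : k ∈ T b) :
    b ∉ interior μ.SD := by
  intro h
  rw [hT.support b fun hb => (Finset.mem_sdiff.1 hb).2 h] at hk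
  simp at hk

theorem finite_letterTabs (d : Prop) (l μ : StrictPartition) (lo hi : ℕ) :
    {T : Filling | IsTab d l μ T ∧ ∀ b, ∀ k ∈ T b, lo ≤ k ∧ k < hi}.Finite := by
  classical
  let e : (l.SD → (Finset.range hi).powerset) → Filling :=
    fun g b => if h : b ∈ l.SD then (g ⟨b, h⟩ : Finset ℕ) else ∅
  refine (Set.finite_range e).subset ?_
  rintro T ⟨hT, hk⟩
  refine ⟨fun b => ⟨T b, ?_⟩, ?_⟩
  · rw [Finset.mem_powerset]
    exact fun k hkT => Finset.mem_range.2 (hk _ k hkT).2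
  · funext b
    by_cases h : b ∈ l.SD
    · simp [e, h]
    · simp only [e, h, dite_false]
      exact (hT.support b fun hb => h (Finset.sdiff_subset hb)).symm

/-- The finite set of tableaux of shape `λ // μ` all of whose letters `k` satisfy
`lo ≤ k < hi`. -/
def letterTabs (d : Prop) (l μ : StrictPartition) (lo hi : ℕ) : Finset Filling :=
  (finite_letterTabs d l μ lo hi).toFinset

@[simp]
theorem mem_letterTabs {lo hi : ℕ} :
    T ∈ letterTabs d l μ lo hi ↔ IsTab d l μ T ∧ ∀ b, ∀ k ∈ T b, lo ≤ k ∧ k < hi := by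
  simp [letterTabs]

theorem IsShSVTQ.card_le_size (hT : IsShSVTQ l μ T) : (l.SD \ μ.SD).card ≤ size l T := by
  rw [size, Finset.card_eq_sum_ones]
  calc ∑ b ∈ l.SD \ μ.SD, 1 ≤ ∑ b ∈ l.SD \ μ.SD, (T b).card :=
        Finset.sum_le_sum fun b hb => (hT.nonempty b hb).card_pos
    _ ≤ _ := Finset.sum_le_sum_of_subset Finset.sdiff_subset

/-- Sums over the boxes of `λ` do not depend on `λ`, as long as the tableau fits. -/
theorem IsShSVTQ.sum_eq {M : Type*} [AddCommMonoid M] (hT : IsShSVTQ ν μ T) (h : ν.Sub l)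
    (f : Finset ℕ → M) (hf : f ∅ = 0) : ∑ b ∈ l.SD, f (T b) = ∑ b ∈ ν.SD, f (T b) := by
  refine (Finset.sum_subset (sub_iff_SD_subset.1 h) fun b _ hb => ?_).symm
  rw [hT.support b fun h' => hb (Finset.sdiff_subset h'), hf]

/-! ### Cutting a tableau at a letter -/

/-- The part of a filling formed by the letters `< M`. -/
def lowPart (M : ℕ) (T : Filling) : Filling := fun b => (T b).filter (· < M)

/-- The part of a filling formed by the letters `≥ M`. -/
def highPart (M : ℕ) (T : Filling) : Filling := fun b => (T b).filter (M ≤ ·)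

theorem lowPart_union_highPart (M : ℕ) (T : Filling) (b : ℕ × ℕ) :
    lowPart M T b ∪ highPart M T b = T b := by
  ext k
  simp only [lowPart, highPart, Finset.mem_union, Finset.mem_filter]
  have := lt_or_ge k M
  tauto

theorem disjoint_lowPart_highPart (M : ℕ) (T : Filling) (b : ℕ × ℕ) :
    Disjoint (lowPart M T b) (highPart M T b) := by
  rw [Finset.disjoint_left]
  intro k
  simp only [lowPart, highPart, Finset.mem_filter]
  omega

theorem IsTab.exists_cut (hT : IsTab d l μ T) (h : μ.Sub l) (M : ℕ) :
    ∃ ν, μ.Sub ν ∧ ν.Sub l ∧ IsTab d ν μ (lowPart M T) ∧ IsTab d l ν (highPart M T) := by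
  classical
  have hsub := sub_iff_SD_subset.1 h
  -- the boxes of `μ` together with those that contain a letter `< M`
  obtain ⟨ν, hν⟩ := exists_SD_eq (μ.SD ∪ l.SD.filter fun b => ∃ k ∈ T b, k < M)
    (by
      intro i j hb
      have hb' : (i, j) ∈ l.SD := by
        rcases Finset.mem_union.1 hb with hb | hb
        · exact hsub hb
        · exact (Finset.mem_filter.1 hb).1
      exact ((mem_SD _ _ _).1 hb').1)
    (by
      intro i j hij hb
      rw [Finset.mem_union, Finset.mem_filter] at hb ⊢
      by_cases hμ : (i, j) ∈ μ.SD
      · exact Or.inl hμ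
      right
      rcases hb with hb | ⟨hb, k, hk, hkM⟩
      · rw [mem_SD] at hb hμ
        omega
      · have hl : (i, j) ∈ l.SD := by
          rw [mem_SD] at hb ⊢
          omega
        obtain ⟨p, hp⟩ := hT.nonempty _ (Finset.mem_sdiff.2 ⟨hl, hμ⟩)
        exact ⟨hl, p, hp, (hT.row_le i j p hp k hk).trans_lt hkM⟩)
    (by
      intro i j hb
      have up : ∀ κ : StrictPartition, (i + 1, j) ∈ κ.SD → (i, j) ∈ κ.SD := by
        intro κ hκ
        rw [mem_SD] at hκ ⊢
        have := κ.part_succ_lt (i := i) (by omega)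
        omega
      rw [Finset.mem_union, Finset.mem_filter] at hb ⊢
      by_cases hμ : (i, j) ∈ μ.SD
      · exact Or.inl hμ
      right
      rcases hb with hb | ⟨hb, k, hk, hkM⟩
      · exact absurd (up _ hb) hμ
      · obtain ⟨p, hp⟩ := hT.nonempty _ (Finset.mem_sdiff.2 ⟨up _ hb, hμ⟩)
        exact ⟨up _ hb, p, hp, (hT.col_le i j p hp k hk).trans_lt hkM⟩)
  have hμν : μ.SD ⊆ ν.SD := hν ▸ Finset.subset_union_left
  have hνl : ν.SD ⊆ l.SD := hν ▸ Finset.union_subset hsub (Finset.filter_subset _ _)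
  have hlow : ∀ b k, k ∈ T b → k < M → b ∈ ν.SD := fun b k hk hkM => by
    rw [hν, Finset.mem_union, Finset.mem_filter]
    exact Or.inr ⟨hT.mem_SD hk, k, hk, hkM⟩
  have hnew : ∀ b, b ∈ ν.SD → b ∉ μ.SD → ∃ k ∈ T b, k < M := fun b hb hb' => by
    rw [hν, Finset.mem_union, Finset.mem_filter] at hb
    exact (hb.resolve_left hb').2
  have hint : ∀ b k, k ∈ T b → M ≤ k → b ∉ interior ν.SD := by
    rintro ⟨i, j⟩ k hk hkM hb
    have hμ := hT.notMem_interior hk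
    rw [mem_interior_SD] at hb hμ
    have hbμ : ∀ c, c ∈ ν.SD → (∀ q ∈ T c, k ≤ q) → c ∈ μ.SD := by
      intro c hc hq
      by_contra hcμ
      obtain ⟨q, hqT, hqM⟩ := hnew c hc hcμ
      have := hq q hqT
      omega
    have hmem : (i, j) ∈ l.SD := hT.mem_SD hk
    rw [mem_SD] at hmem
    rcases hb.2 with hc | hc
    · have := hbμ _ hc (hT.col_le i j k hk)
      apply hμ
      refine ⟨?_, Or.inl this⟩
      rw [mem_SD] at this ⊢
      have := μ.part_succ_lt (i := i) (by omega)
      omega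
    · have := hbμ _ hc (hT.row_le i j k hk)
      apply hμ
      refine ⟨?_, Or.inr this⟩
      rw [mem_SD] at this ⊢
      omega
  refine ⟨ν, sub_iff_SD_subset.2 hμν, sub_iff_SD_subset.2 hνl, ?_, ?_⟩
  · refine ⟨⟨fun b hb => ?_, fun b hb => ?_, fun i j p hp q hq => ?_, fun i j p hp q hq => ?_,
      fun i j p hp => ?_, fun i j p hp => ?_⟩, fun hd i p hp => ?_⟩
    · rw [Finset.eq_empty_iff_forall_notMem]
      intro k hk
      rw [lowPart, Finset.mem_filter] at hk
      exact hb (Finset.mem_sdiff.2 ⟨hlow b k hk.1 hk.2, hT.notMem_interior hk.1⟩)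
    · obtain ⟨k, hk⟩ := hnew b (Finset.mem_sdiff.1 hb).1 (Finset.mem_sdiff.1 hb).2
      exact ⟨k, Finset.mem_filter.2 hk⟩
    all_goals simp only [lowPart, Finset.mem_inter, Finset.mem_filter] at *
    · exact hT.row_le i j p hp.1 q hq.1
    · exact hT.col_le i j p hp.1 q hq.1
    · exact hT.row_inter i j p (Finset.mem_inter.2 ⟨hp.1.1, hp.2.1⟩)
    · exact hT.col_inter i j p (Finset.mem_inter.2 ⟨hp.1.1, hp.2.1⟩)
    · exact hT.diag hd i p hp.1
  · refine ⟨⟨fun b hb => ?_, fun b hb => ?_, fun i j p hp q hq => ?_, fun i j p hp q hq => ?_,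
      fun i j p hp => ?_, fun i j p hp => ?_⟩, fun hd i p hp => ?_⟩
    · rw [Finset.eq_empty_iff_forall_notMem]
      intro k hk
      rw [highPart, Finset.mem_filter] at hk
      exact hb (Finset.mem_sdiff.2 ⟨hT.mem_SD hk.1, hint b k hk.1 hk.2⟩)
    · rw [Finset.mem_sdiff] at hb
      obtain ⟨k, hk⟩ := hT.nonempty b (Finset.mem_sdiff.2 ⟨hb.1, fun h' => hb.2 (hμν h')⟩)
      refine ⟨k, Finset.mem_filter.2 ⟨hk, ?_⟩⟩
      by_contra hkM
      exact hb.2 (hlow b k hk (by omega))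
    all_goals simp only [highPart, Finset.mem_inter, Finset.mem_filter] at *
    · exact hT.row_le i j p hp.1 q hq.1
    · exact hT.col_le i j p hp.1 q hq.1
    · exact hT.row_inter i j p (Finset.mem_inter.2 ⟨hp.1.1, hp.2.1⟩)
    · exact hT.col_inter i j p (Finset.mem_inter.2 ⟨hp.1.1, hp.2.1⟩)
    · exact hT.diag hd i p hp.1

theorem IsTab.glue {M : ℕ} {T₁ T₂ : Filling} (hμν : μ.Sub ν) (hνl : ν.Sub l)
    (h₁ : IsTab d ν μ T₁) (h₂ : IsTab d l ν T₂) (hT₁ : ∀ b, ∀ k ∈ T₁ b, k < M)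
    (hT₂ : ∀ b, ∀ k ∈ T₂ b, M ≤ k) : IsTab d l μ (fun b => T₁ b ∪ T₂ b) := by
  have hμν' := sub_iff_SD_subset.1 hμν
  have hνl' := sub_iff_SD_subset.1 hνl
  -- a letter `≥ M` is never to the left of or above a letter `< M`
  have hrow : ∀ i j p q, p ∈ T₂ (i, j) → q ∉ T₁ (i, j + 1) := by
    intro i j p q hp hq
    have hb := h₁.mem_SD hq
    have hb' := h₂.mem_SD hp
    refine h₂.notMem_interior hp ((mem_interior_SD _ _ _).2 ⟨?_, Or.inr hb⟩)
    rw [mem_SD] at hb hb' ⊢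
    omega
  have hcol : ∀ i j p q, p ∈ T₂ (i, j) → q ∉ T₁ (i + 1, j) := by
    intro i j p q hp hq
    have hb := h₁.mem_SD hq
    refine h₂.notMem_interior hp ((mem_interior_SD _ _ _).2 ⟨?_, Or.inl hb⟩)
    rw [mem_SD] at hb ⊢
    have := ν.part_succ_lt (i := i) (by omega)
    omega
  refine ⟨⟨fun b hb => ?_, fun b hb => ?_, fun i j p hp q hq => ?_, fun i j p hp q hq => ?_,
      fun i j p hp => ?_, fun i j p hp => ?_⟩, fun hd i p hp => ?_⟩
  · rw [Finset.mem_sdiff] at hb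
    rw [Finset.union_eq_empty]
    constructor
    · refine h₁.support b fun h => hb ?_
      rw [Finset.mem_sdiff] at h
      exact ⟨hνl' h.1, h.2⟩
    · refine h₂.support b fun h => hb ?_
      rw [Finset.mem_sdiff] at h
      exact ⟨h.1, fun h' => h.2 (interior_mono hμν' h')⟩
  · rw [Finset.mem_sdiff] at hb
    by_cases hbν : b ∈ ν.SD
    · exact (h₁.nonempty b (Finset.mem_sdiff.2 ⟨hbν, hb.2⟩)).mono Finset.subset_union_left
    · exact (h₂.nonempty b (Finset.mem_sdiff.2 ⟨hb.1, hbν⟩)).mono Finset.subset_union_right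
  all_goals simp only [Finset.mem_inter, Finset.mem_union] at *
  · rcases hp with hp | hp <;> rcases hq with hq | hq
    · exact h₁.row_le i j p hp q hq
    · exact ((hT₁ _ p hp).trans_le (hT₂ _ q hq)).le
    · exact absurd hq (hrow i j p q hp)
    · exact h₂.row_le i j p hp q hq
  · rcases hp with hp | hp <;> rcases hq with hq | hq
    · exact h₁.col_le i j p hp q hq
    · exact ((hT₁ _ p hp).trans_le (hT₂ _ q hq)).le
    · exact absurd hq (hcol i j p q hp)
    · exact h₂.col_le i j p hp q hq
  · rcases hp with ⟨hp | hp, hq | hq⟩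
    · exact h₁.row_inter i j p (Finset.mem_inter.2 ⟨hp, hq⟩)
    · exact absurd (hT₁ _ p hp) (hT₂ _ p hq).not_gt
    · exact absurd hq (hrow i j p p hp)
    · exact h₂.row_inter i j p (Finset.mem_inter.2 ⟨hp, hq⟩)
  · rcases hp with ⟨hp | hp, hq | hq⟩
    · exact h₁.col_inter i j p (Finset.mem_inter.2 ⟨hp, hq⟩)
    · exact absurd (hT₁ _ p hp) (hT₂ _ p hq).not_gt
    · exact absurd hq (hcol i j p p hp)
    · exact h₂.col_inter i j p (Finset.mem_inter.2 ⟨hp, hq⟩)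
  · exact hp.elim (h₁.diag hd i p) (h₂.diag hd i p)

/-- The outer shape of a tableau is determined by the inner shape and the occupied boxes. -/
theorem IsTab.shape_unique {ν' : StrictPartition} (h : IsTab d ν μ T) (h' : IsTab d ν' μ T)
    (hμ : μ.Sub ν) (hμ' : μ.Sub ν') : ν = ν' := by
  have key : ∀ {κ κ' : StrictPartition}, IsTab d κ μ T → IsTab d κ' μ T → μ.Sub κ' →
      κ.SD ⊆ κ'.SD := by
    intro κ κ' hκ hκ' hs b hb
    by_cases hbμ : b ∈ μ.SD
    · exact sub_iff_SD_subset.1 hs hbμ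
    · obtain ⟨k, hk⟩ := hκ.nonempty b (Finset.mem_sdiff.2 ⟨hb, hbμ⟩)
      exact hκ'.mem_SD hk
  exact SD_injective ((key h h' hμ').antisymm (key h' h hμ))

theorem lowPart_glue {M : ℕ} {T₁ T₂ : Filling} (hT₁ : ∀ b, ∀ k ∈ T₁ b, k < M)
    (hT₂ : ∀ b, ∀ k ∈ T₂ b, M ≤ k) : lowPart M (fun b => T₁ b ∪ T₂ b) = T₁ := by
  funext b
  ext k
  simp only [lowPart, Finset.mem_filter, Finset.mem_union]
  refine ⟨fun ⟨h, hk⟩ => h.resolve_right fun h' => ?_, fun h => ⟨Or.inl h, hT₁ b k h⟩⟩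
  exact absurd hk (hT₂ b k h').not_gt

theorem highPart_glue {M : ℕ} {T₁ T₂ : Filling} (hT₁ : ∀ b, ∀ k ∈ T₁ b, k < M)
    (hT₂ : ∀ b, ∀ k ∈ T₂ b, M ≤ k) : highPart M (fun b => T₁ b ∪ T₂ b) = T₂ := by
  funext b
  ext k
  simp only [highPart, Finset.mem_filter, Finset.mem_union]
  refine ⟨fun ⟨h, hk⟩ => h.resolve_left fun h' => ?_, fun h => ⟨Or.inr h, hT₂ b k h⟩⟩
  exact absurd (hT₁ b k h') hk.not_gt

/-- Cutting at the letter `M` is a bijection from the tableaux of shape `λ // μ` onto the pairs of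
tableaux of shapes `ν // μ` and `λ // ν`, for all intermediate `ν`. -/
theorem sum_cut (d : Prop) (h : μ.Sub l) {M hi : ℕ} (hM : M ≤ hi) (F : Filling → Filling → ℝ) :
    ∑ T ∈ letterTabs d l μ 0 hi, F (lowPart M T) (highPart M T) =
      ∑ ν ∈ between μ l, ∑ T₁ ∈ letterTabs d ν μ 0 M, ∑ T₂ ∈ letterTabs d l ν M hi, F T₁ T₂ := by
  simp_rw [← Finset.sum_product']
  rw [Finset.sum_sigma']
  symm
  refine Finset.sum_bij (fun x _ => fun b => x.2.1 b ∪ x.2.2 b) ?_ ?_ ?_ ?_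
  · rintro ⟨ν, T₁, T₂⟩ hx
    simp only [Finset.mem_sigma, Finset.mem_product, mem_between, mem_letterTabs] at hx
    obtain ⟨⟨hμν, hνl⟩, ⟨h₁, hk₁⟩, h₂, hk₂⟩ := hx
    rw [mem_letterTabs]
    refine ⟨h₁.glue hμν hνl h₂ (fun b k hk => (hk₁ b k hk).2) fun b k hk => (hk₂ b k hk).1,
      fun b k hk => ⟨Nat.zero_le _, ?_⟩⟩
    rcases Finset.mem_union.1 hk with hk | hk
    · exact (hk₁ b k hk).2.trans_le hM
    · exact (hk₂ b k hk).2
  · rintro ⟨ν, T₁, T₂⟩ hx ⟨ν', T₁', T₂'⟩ hx' heq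
    simp only [Finset.mem_sigma, Finset.mem_product, mem_between, mem_letterTabs] at hx hx' heq
    obtain ⟨⟨hμν, -⟩, ⟨h₁, hk₁⟩, -, hk₂⟩ := hx
    obtain ⟨⟨hμν', -⟩, ⟨h₁', hk₁'⟩, -, hk₂'⟩ := hx'
    have e₁ := congrArg (lowPart M) heq
    have e₂ := congrArg (highPart M) heq
    rw [lowPart_glue (fun b k hk => (hk₁ b k hk).2) fun b k hk => (hk₂ b k hk).1,
      lowPart_glue (fun b k hk => (hk₁' b k hk).2) fun b k hk => (hk₂' b k hk).1] at e₁
    rw [highPart_glue (fun b k hk => (hk₁ b k hk).2) fun b k hk => (hk₂ b k hk).1,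
      highPart_glue (fun b k hk => (hk₁' b k hk).2) fun b k hk => (hk₂' b k hk).1] at e₂
    subst e₁ e₂
    obtain rfl := h₁.shape_unique h₁' hμν hμν'
    rfl
  · intro T hT
    rw [mem_letterTabs] at hT
    obtain ⟨ν, hμν, hνl, h₁, h₂⟩ := hT.1.exists_cut h M
    refine ⟨⟨ν, lowPart M T, highPart M T⟩, ?_, funext (lowPart_union_highPart M T)⟩
    simp only [Finset.mem_sigma, Finset.mem_product, mem_between, mem_letterTabs]
    refine ⟨⟨hμν, hνl⟩, ⟨h₁, fun b k hk => ⟨Nat.zero_le _, (Finset.mem_filter.1 hk).2⟩⟩, h₂,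
      fun b k hk => ?_⟩
    have := Finset.mem_filter.1 hk
    exact ⟨this.2, (hT.2 b k this.1).2⟩
  · rintro ⟨ν, T₁, T₂⟩ hx
    simp only [Finset.mem_sigma, Finset.mem_product, mem_between, mem_letterTabs] at hx
    obtain ⟨-, ⟨-, hk₁⟩, -, hk₂⟩ := hx
    rw [lowPart_glue (fun b k hk => (hk₁ b k hk).2) fun b k hk => (hk₂ b k hk).1,
      highPart_glue (fun b k hk => (hk₁ b k hk).2) fun b k hk => (hk₂ b k hk).1]

/-! ### Coefficients of the tableau series -/

/-- The sign `(-1)^(|T| - |λ/μ|)` of a tableau of shape `λ // μ`. -/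
def tabSign (l μ : StrictPartition) (T : Filling) : ℝ := (-1) ^ (size l T - (l.SD \ μ.SD).card)

/-- `GP^{(-1)}_{λ // μ}` if `d` holds, and `GQ^{(-1)}_{λ // μ}` otherwise. -/
def tabSeries (d : Prop) (l μ : StrictPartition) : MvPowerSeries ℕ ℝ :=
  tableauSeries (IsTab d l μ) (-1) l μ

theorem tabSeries_true (l μ : StrictPartition) : tabSeries True l μ = GPbar l μ := by
  have : IsTab True l μ = IsShSVTP l μ := funext fun _ => propext isTab_true
  rw [tabSeries, this]
  rfl

theorem tabSeries_false (l μ : StrictPartition) : tabSeries False l μ = GQbar l μ := by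
  have : IsTab False l μ = IsShSVTQ l μ := funext fun _ => propext isTab_false
  rw [tabSeries, this]
  rfl

theorem tabSeries_of_not_sub (d : Prop) (h : ¬ μ.Sub l) : tabSeries d l μ = 0 := by
  funext m
  simp only [tabSeries, tableauSeries, if_neg h]
  rfl

theorem weight_apply (l : StrictPartition) (T : Filling) (i : ℕ) :
    weight l T i = ∑ b ∈ l.SD, ((T b).filter fun k => k / 2 = i).card := by
  simp [weight, Finsupp.finsetSum_apply, Finsupp.single_apply]

theorem IsShSVTQ.mem_support_weight_iff (hT : IsShSVTQ l μ T) (i : ℕ) :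
    i ∈ (weight l T).support ↔ ∃ b, ∃ k ∈ T b, k / 2 = i := by
  rw [Finsupp.mem_support_iff, weight_apply, ne_eq, Finset.sum_eq_zero_iff]
  simp only [Finset.card_eq_zero, Finset.filter_eq_empty_iff]
  push Not
  constructor
  · rintro ⟨b, -, k, hk, h⟩
    exact ⟨b, k, hk, h⟩
  · rintro ⟨b, k, hk, h⟩
    exact ⟨b, hT.mem_SD hk, k, hk, h⟩

theorem coeff_tabSeries (d : Prop) (h : μ.Sub l) {m : ℕ →₀ ℕ} {hi : ℕ}
    (hm : ∀ i ∈ m.support, 2 * i + 2 ≤ hi) :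
    MvPowerSeries.coeff m (tabSeries d l μ) =
      ∑ T ∈ letterTabs d l μ 0 hi, if weight l T = m then tabSign l μ T else 0 := by
  classical
  change tabSeries d l μ m = _
  have hmem : ∀ T, (IsTab d l μ T ∧ weight l T = m) ↔
      T ∈ (letterTabs d l μ 0 hi).filter fun T => weight l T = m := by
    intro T
    rw [Finset.mem_filter, mem_letterTabs]
    constructor
    · rintro ⟨hT, hw⟩
      refine ⟨⟨hT, fun b k hk => ⟨Nat.zero_le _, ?_⟩⟩, hw⟩
      have := hm (k / 2) (hw ▸ (hT.mem_support_weight_iff _).2 ⟨b, k, hk, rfl⟩)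
      omega
    · rintro ⟨⟨hT, -⟩, hw⟩
      exact ⟨hT, hw⟩
  rw [tabSeries, tableauSeries, if_pos h, ← Finset.sum_filter]
  simp_rw [hmem]
  exact finsum_mem_finset_eq_sum _ _

theorem size_cut (l : StrictPartition) (M : ℕ) (T : Filling) :
    size l T = size l (lowPart M T) + size l (highPart M T) := by
  rw [size, size, size, ← Finset.sum_add_distrib]
  refine Finset.sum_congr rfl fun b _ => ?_
  rw [← Finset.card_union_of_disjoint (disjoint_lowPart_highPart M T b), lowPart_union_highPart]

theorem weight_cut (l : StrictPartition) (M : ℕ) (T : Filling) :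
    weight l T = weight l (lowPart M T) + weight l (highPart M T) := by
  rw [weight, weight, weight, ← Finset.sum_add_distrib]
  refine Finset.sum_congr rfl fun b _ => ?_
  rw [← Finset.sum_union (disjoint_lowPart_highPart M T b), lowPart_union_highPart]

theorem tabSign_eq (hT : IsShSVTQ l μ T) :
    tabSign l μ T = (-1) ^ size l T * (-1) ^ (l.SD \ μ.SD).card := by
  rw [tabSign, ← pow_add]
  have := hT.card_le_size
  exact neg_one_pow_congr (by rw [Nat.even_add, Nat.even_sub this])

theorem card_skew_add (hμν : μ.Sub ν) (hνl : ν.Sub l) :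
    (l.SD \ μ.SD).card = (ν.SD \ μ.SD).card + (l.SD \ ν.SD).card := by
  have h₁ := sub_iff_SD_subset.1 hμν
  have h₂ := sub_iff_SD_subset.1 hνl
  rw [Finset.card_sdiff_of_subset h₁, Finset.card_sdiff_of_subset h₂,
    Finset.card_sdiff_of_subset (h₁.trans h₂)]
  have := Finset.card_le_card h₁
  have := Finset.card_le_card h₂
  omega

/-- Weighted form of the bijection given by cutting tableaux at the letter `M`. -/
theorem sum_tabSign_cut (d : Prop) (h : μ.Sub l) {M hi : ℕ} (hM : M ≤ hi)
    (F : (ℕ →₀ ℕ) → (ℕ →₀ ℕ) → ℝ) :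
    ∑ T ∈ letterTabs d l μ 0 hi,
        tabSign l μ T * F (weight l (lowPart M T)) (weight l (highPart M T)) =
      ∑ ν ∈ between μ l, ∑ T₁ ∈ letterTabs d ν μ 0 M, ∑ T₂ ∈ letterTabs d l ν M hi,
        tabSign ν μ T₁ * tabSign l ν T₂ * F (weight ν T₁) (weight l T₂) := by
  have key := sum_cut d h hM fun T₁ T₂ =>
    ((-1) ^ size l T₁ * (-1) ^ size l T₂ * (-1) ^ (l.SD \ μ.SD).card) *
      F (weight l T₁) (weight l T₂)
  refine Eq.trans (Finset.sum_congr rfl fun T hT => ?_) (key.trans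
    (Finset.sum_congr rfl fun ν hν => Finset.sum_congr rfl fun T₁ h₁ =>
      Finset.sum_congr rfl fun T₂ h₂ => ?_))
  · rw [mem_letterTabs] at hT
    rw [tabSign_eq hT.1.toIsShSVTQ, size_cut l M T, pow_add]
  · rw [mem_letterTabs] at h₁ h₂
    rw [mem_between] at hν
    have e₁ : size l T₁ = size ν T₁ :=
      h₁.1.sum_eq hν.2 Finset.card Finset.card_empty
    have e₂ : weight l T₁ = weight ν T₁ :=
      h₁.1.sum_eq hν.2 (fun s => ∑ k ∈ s, Finsupp.single (k / 2) 1) Finset.sum_empty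
    rw [tabSign_eq h₁.1.toIsShSVTQ, tabSign_eq h₂.1.toIsShSVTQ, e₁, e₂,
      card_skew_add hν.1 hν.2, pow_add]
    ring

/-! ### Renaming the variables -/

/-- The filling obtained by replacing `x_i` by `x_{i+N}`, that is, by adding `2 N` to all
letters. -/
def shiftLetters (N : ℕ) (T : Filling) : Filling :=
  fun b => (T b).map (addRightEmbedding (2 * N))

theorem mem_shiftLetters {N : ℕ} {b : ℕ × ℕ} {k : ℕ} :
    k ∈ shiftLetters N T b ↔ ∃ p ∈ T b, p + 2 * N = k := by
  simp [shiftLetters]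

theorem isTab_shiftLetters {N : ℕ} : IsTab d l μ (shiftLetters N T) ↔ IsTab d l μ T := by
  have hmem : ∀ b p, p + 2 * N ∈ shiftLetters N T b ↔ p ∈ T b := fun b p => by
    simp [mem_shiftLetters]
  constructor
  · intro h
    refine ⟨⟨fun b hb => ?_, fun b hb => ?_, fun i j p hp q hq => ?_, fun i j p hp q hq => ?_,
      fun i j p hp => ?_, fun i j p hp => ?_⟩, fun hd i p hp => ?_⟩
    · simpa [shiftLetters] using h.support b hb
    · simpa [shiftLetters] using h.nonempty b hb
    · have := h.row_le i j _ ((hmem _ p).2 hp) _ ((hmem _ q).2 hq)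
      omega
    · have := h.col_le i j _ ((hmem _ p).2 hp) _ ((hmem _ q).2 hq)
      omega
    · rw [Finset.mem_inter] at hp
      have := h.row_inter i j (p + 2 * N)
        (Finset.mem_inter.2 ⟨(hmem _ p).2 hp.1, (hmem _ p).2 hp.2⟩)
      rw [Nat.odd_iff] at this ⊢
      omega
    · rw [Finset.mem_inter] at hp
      have := h.col_inter i j (p + 2 * N)
        (Finset.mem_inter.2 ⟨(hmem _ p).2 hp.1, (hmem _ p).2 hp.2⟩)
      rw [Nat.even_iff] at this ⊢
      omega
    · have := h.diag hd i _ ((hmem _ p).2 hp)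
      rw [Nat.odd_iff] at this ⊢
      omega
  · intro h
    refine ⟨⟨fun b hb => ?_, fun b hb => ?_, fun i j p hp q hq => ?_, fun i j p hp q hq => ?_,
      fun i j p hp => ?_, fun i j p hp => ?_⟩, fun hd i p hp => ?_⟩
    · simpa [shiftLetters] using h.support b hb
    · simpa [shiftLetters] using h.nonempty b hb
    all_goals simp only [Finset.mem_inter, mem_shiftLetters] at *
    · obtain ⟨p, hp, rfl⟩ := hp
      obtain ⟨q, hq, rfl⟩ := hq
      have := h.row_le i j p hp q hq
      omega
    · obtain ⟨p, hp, rfl⟩ := hp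
      obtain ⟨q, hq, rfl⟩ := hq
      have := h.col_le i j p hp q hq
      omega
    · obtain ⟨⟨p, hp, rfl⟩, q, hq, hqp⟩ := hp
      obtain rfl : q = p := by omega
      have := h.row_inter i j q (Finset.mem_inter.2 ⟨hp, hq⟩)
      rw [Nat.odd_iff] at this ⊢
      omega
    · obtain ⟨⟨p, hp, rfl⟩, q, hq, hqp⟩ := hp
      obtain rfl : q = p := by omega
      have := h.col_inter i j q (Finset.mem_inter.2 ⟨hp, hq⟩)
      rw [Nat.even_iff] at this ⊢
      omega
    · obtain ⟨p, hp, rfl⟩ := hp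
      have := h.diag hd i p hp
      rw [Nat.odd_iff] at this ⊢
      omega

theorem tabSign_shiftLetters (l μ : StrictPartition) (N : ℕ) (T : Filling) :
    tabSign l μ (shiftLetters N T) = tabSign l μ T := by
  simp [tabSign, size, shiftLetters]

theorem weight_shiftLetters (l : StrictPartition) (N : ℕ) (T : Filling) :
    weight l (shiftLetters N T) = (weight l T).mapDomain (· + N) := by
  rw [weight, weight, Finsupp.mapDomain_finsetSum]
  refine Finset.sum_congr rfl fun b _ => ?_
  rw [shiftLetters, Finset.sum_map, Finsupp.mapDomain_finsetSum]
  refine Finset.sum_congr rfl fun k _ => ?_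
  rw [Finsupp.mapDomain_single]
  congr 1
  simp only [addRightEmbedding_apply]
  omega

theorem sum_shiftLetters (d : Prop) (l μ : StrictPartition) (N r : ℕ) (F : Filling → ℝ) :
    ∑ T ∈ letterTabs d l μ (2 * N) (2 * N + r), F T =
      ∑ T ∈ letterTabs d l μ 0 r, F (shiftLetters N T) := by
  symm
  refine Finset.sum_bij (fun T _ => shiftLetters N T) ?_ ?_ ?_ fun _ _ => rfl
  · intro T hT
    rw [mem_letterTabs] at hT ⊢
    refine ⟨isTab_shiftLetters.2 hT.1, fun b k hk => ?_⟩
    obtain ⟨p, hp, rfl⟩ := mem_shiftLetters.1 hk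
    have := hT.2 b p hp
    omega
  · intro T _ T' _ h
    funext b
    exact Finset.map_injective _ (congrFun h b)
  · intro T hT
    rw [mem_letterTabs] at hT
    have hshift : shiftLetters N (fun b => (T b).image (· - 2 * N)) = T := by
      funext b
      ext k
      simp only [mem_shiftLetters, Finset.mem_image]
      constructor
      · rintro ⟨_, ⟨q, hq, rfl⟩, rfl⟩
        rwa [Nat.sub_add_cancel (hT.2 b q hq).1]
      · exact fun hk => ⟨_, ⟨k, hk, rfl⟩, Nat.sub_add_cancel (hT.2 b k hk).1⟩
    refine ⟨fun b => (T b).image (· - 2 * N), ?_, hshift⟩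
    rw [mem_letterTabs]
    refine ⟨isTab_shiftLetters.1 (hshift.symm ▸ hT.1), fun b k hk => ?_⟩
    obtain ⟨q, hq, rfl⟩ := Finset.mem_image.1 hk
    have := hT.2 b q hq
    omega

/-- An exponent splits uniquely into one of `x₁, …, x_N` and one of the other variables. -/
theorem add_mapDomain_inj {N : ℕ} {a a' b b' : ℕ →₀ ℕ} (ha : ∀ i ∈ a.support, i < N)
    (ha' : ∀ i ∈ a'.support, i < N)
    (h : a + b.mapDomain (· + N) = a' + b'.mapDomain (· + N)) : a = a' ∧ b = b' := by
  have hzero : ∀ (c : ℕ →₀ ℕ) i, i < N → c.mapDomain (· + N) i = 0 := by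
    intro c i hi
    refine Finsupp.mapDomain_of_notMem_range _ _ ?_
    rintro ⟨j, rfl⟩
    simp at hi
  have haa : a = a' := by
    ext i
    by_cases hi : i < N
    · have := DFunLike.congr_fun h i
      simpa [hzero _ i hi] using this
    · rw [Finsupp.notMem_support_iff.1 fun h' => hi (ha i h'),
        Finsupp.notMem_support_iff.1 fun h' => hi (ha' i h')]
  subst haa
  exact ⟨rfl, Finsupp.mapDomain_injective (add_left_injective N) (add_left_cancel h)⟩

/-- The coproduct formula `G_{λ // μ}(x, y) = ∑_ν G_{ν // μ}(x) G_{λ // ν}(y)`. -/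
theorem coeff_add_tabSeries (d : Prop) (h : μ.Sub l) (N : ℕ) (a b : ℕ →₀ ℕ)
    (ha : ∀ i ∈ a.support, i < N) :
    MvPowerSeries.coeff (a + b.mapDomain (· + N)) (tabSeries d l μ) =
      ∑ ν ∈ between μ l, MvPowerSeries.coeff a (tabSeries d ν μ) *
        MvPowerSeries.coeff b (tabSeries d l ν) := by
  classical
  set r := b.support.sup (fun i => 2 * i + 2) with hr
  have hb : ∀ i ∈ b.support, 2 * i + 2 ≤ r := fun i hi =>
    Finset.le_sup (f := fun i => 2 * i + 2) hi
  have hm : ∀ i ∈ (a + b.mapDomain (· + N)).support, 2 * i + 2 ≤ 2 * N + r := by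
    intro i hi
    rcases Finset.mem_union.1 (Finsupp.support_add hi) with hi | hi
    · have := ha i hi
      omega
    · obtain ⟨j, hj, rfl⟩ := Finset.mem_image.1 (Finsupp.mapDomain_support hi)
      have := hb j hj
      omega
  have ha' : ∀ i ∈ a.support, 2 * i + 2 ≤ 2 * N := fun i hi => by
    have := ha i hi
    omega
  rw [coeff_tabSeries d h hm]
  have key := sum_tabSign_cut d h (Nat.le_add_right (2 * N) r)
    fun u v => if u + v = a + b.mapDomain (· + N) then 1 else 0
  refine Eq.trans (Finset.sum_congr rfl fun T hT => ?_) (key.trans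
    (Finset.sum_congr rfl fun ν hν => ?_))
  · rw [← weight_cut, mul_ite, mul_one, mul_zero]
  · rw [mem_between] at hν
    rw [coeff_tabSeries d hν.1 ha', coeff_tabSeries d hν.2 hb, Finset.sum_mul_sum]
    refine Finset.sum_congr rfl fun T₁ h₁ => ?_
    rw [sum_shiftLetters]
    refine Finset.sum_congr rfl fun T₂ _ => ?_
    rw [mem_letterTabs] at h₁
    have hw : ∀ i ∈ (weight ν T₁).support, i < N := by
      intro i hi
      obtain ⟨c, k, hk, rfl⟩ := (h₁.1.mem_support_weight_iff i).1 hi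
      have := (h₁.2 c k hk).2
      omega
    rw [tabSign_shiftLetters, weight_shiftLetters]
    by_cases hab : weight ν T₁ = a ∧ weight l T₂ = b
    · simp [hab.1, hab.2]
    · rw [if_neg fun h' => hab (add_mapDomain_inj hw ha h')]
      rw [not_and_or] at hab
      rcases hab with hab | hab <;> simp [hab]

/-! ### Tableaux with a single letter -/

theorem mem_letterTabs_zero :
    T ∈ letterTabs d l μ 0 1 ↔ (∀ b, T b ⊆ {0}) ∧ (∀ b, 0 ∈ T b → b ∈ l.SD \ interior μ.SD) ∧
      (∀ b ∈ l.SD \ μ.SD, 0 ∈ T b) ∧ (∀ i j, 0 ∈ T (i, j) → 0 ∉ T (i, j + 1)) ∧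
      (d → ∀ i, 0 ∉ T (i, i)) := by
  rw [mem_letterTabs]
  constructor
  · rintro ⟨hT, hk⟩
    have hk' : ∀ b, ∀ k ∈ T b, k = 0 := fun b k h => by
      have := hk b k h
      omega
    refine ⟨fun b k h => by simp [hk' b k h], fun b hb => ?_, fun b hb => ?_, fun i j h h' => ?_,
      fun hd i h => ?_⟩
    · exact Finset.mem_sdiff.2 ⟨hT.mem_SD hb, hT.notMem_interior hb⟩
    · obtain ⟨k, h⟩ := hT.nonempty b hb
      rwa [hk' b k h] at h
    · simpa using hT.row_inter i j 0 (Finset.mem_inter.2 ⟨h, h'⟩)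
    · simpa using hT.diag hd i 0 h
  · rintro ⟨hk, hsupp, hne, hrow, hdiag⟩
    have hk' : ∀ b, ∀ k ∈ T b, k = 0 := fun b k h => by simpa using hk b h
    refine ⟨⟨⟨fun b hb => ?_, fun b hb => ⟨0, hne b hb⟩, fun i j p hp q hq => ?_,
      fun i j p hp q hq => ?_, fun i j p hp => ?_, fun i j p hp => ?_⟩, fun hd i p hp => ?_⟩,
      fun b k h => ?_⟩
    · rw [Finset.eq_empty_iff_forall_notMem]
      intro k h
      have := hk' b k h
      subst this
      exact hb (hsupp b h)
    · rw [hk' _ p hp, hk' _ q hq]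
    · rw [hk' _ p hp, hk' _ q hq]
    · rw [Finset.mem_inter] at hp
      obtain rfl := hk' _ p hp.1
      exact absurd hp.2 (hrow i j hp.1)
    · rw [Finset.mem_inter] at hp
      obtain rfl := hk' _ p hp.1
      exact Even.zero
    · obtain rfl := hk' _ p hp
      exact absurd hp (hdiag hd i)
    · rw [hk' b k h]
      omega

theorem mem_letterTabs_one :
    T ∈ letterTabs d l μ 1 2 ↔ (∀ b, T b ⊆ {1}) ∧ (∀ b, 1 ∈ T b → b ∈ l.SD \ interior μ.SD) ∧
      (∀ b ∈ l.SD \ μ.SD, 1 ∈ T b) ∧ (∀ i j, 1 ∈ T (i, j) → 1 ∉ T (i + 1, j)) := by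
  rw [mem_letterTabs]
  constructor
  · rintro ⟨hT, hk⟩
    have hk' : ∀ b, ∀ k ∈ T b, k = 1 := fun b k h => by
      have := hk b k h
      omega
    refine ⟨fun b k h => by simp [hk' b k h], fun b hb => ?_, fun b hb => ?_, fun i j h h' => ?_⟩
    · exact Finset.mem_sdiff.2 ⟨hT.mem_SD hb, hT.notMem_interior hb⟩
    · obtain ⟨k, h⟩ := hT.nonempty b hb
      rwa [hk' b k h] at h
    · simpa using hT.col_inter i j 1 (Finset.mem_inter.2 ⟨h, h'⟩)
  · rintro ⟨hk, hsupp, hne, hcol⟩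
    have hk' : ∀ b, ∀ k ∈ T b, k = 1 := fun b k h => by simpa using hk b h
    refine ⟨⟨⟨fun b hb => ?_, fun b hb => ⟨1, hne b hb⟩, fun i j p hp q hq => ?_,
      fun i j p hp q hq => ?_, fun i j p hp => ?_, fun i j p hp => ?_⟩, fun hd i p hp => ?_⟩,
      fun b k h => ?_⟩
    · rw [Finset.eq_empty_iff_forall_notMem]
      intro k h
      have := hk' b k h
      subst this
      exact hb (hsupp b h)
    · rw [hk' _ p hp, hk' _ q hq]
    · rw [hk' _ p hp, hk' _ q hq]
    · rw [Finset.mem_inter] at hp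
      obtain rfl := hk' _ p hp.1
      exact odd_one
    · rw [Finset.mem_inter] at hp
      obtain rfl := hk' _ p hp.1
      exact absurd hp.2 (hcol i j hp.1)
    · obtain rfl := hk' _ p hp
      exact odd_one
    · rw [hk' b k h]
      omega

theorem size_update (T : Filling) {c : ℕ × ℕ} (hc : c ∈ l.SD) (s : Finset ℕ) :
    size l (Function.update T c s) + (T c).card = size l T + s.card := by
  classical
  rw [size, size, ← Finset.add_sum_erase _ _ hc, ← Finset.add_sum_erase _ _ hc,
    Function.update_self]
  have : ∑ b ∈ l.SD.erase c, (Function.update T c s b).card = ∑ b ∈ l.SD.erase c, (T b).card :=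
    Finset.sum_congr rfl fun b hb => by rw [Function.update_of_ne (Finset.ne_of_mem_erase hb)]
  omega

/-- If a letter can be inserted into and removed from a box freely, then signs cancel. -/
theorem sum_tabSign_eq_zero (S : Finset Filling) {c : ℕ × ℕ} (hc : c ∈ l.SD) (k : ℕ)
    (hS : ∀ T ∈ S, IsShSVTQ l μ T ∧ T c ⊆ {k})
    (hup : ∀ T ∈ S, ∀ s ⊆ {k}, Function.update T c s ∈ S) :
    ∑ T ∈ S, tabSign l μ T = 0 := by
  classical
  refine Finset.sum_involution
    (fun T _ => Function.update T c (if T c = ∅ then {k} else ∅)) ?_ ?_ ?_ ?_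
  · intro T hT
    have hT' : Function.update T c (if T c = ∅ then {k} else ∅) ∈ S := by
      refine hup T hT _ ?_
      split_ifs <;> simp
    rw [tabSign_eq (hS T hT).1, tabSign_eq (hS _ hT').1, ← add_mul]
    have h := size_update T hc (if T c = ∅ then {k} else ∅)
    rcases Finset.subset_singleton_iff.1 (hS T hT).2 with h' | h'
    · rw [if_pos h', h', Finset.card_empty, Finset.card_singleton, add_zero] at h
      rw [if_pos h', h, pow_succ]
      ring
    · have hne : T c ≠ ∅ := by simp [h']
      rw [if_neg hne, h', Finset.card_empty, Finset.card_singleton, add_zero] at h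
      rw [if_neg hne, ← h, pow_succ]
      ring
  · intro T hT _ heq
    have h := congrFun heq c
    rw [Function.update_self] at h
    split_ifs at h with h'
    · rw [h'] at h
      simp at h
    · exact h' h.symm
  · intro T hT
    refine hup T hT _ ?_
    split_ifs <;> simp
  · intro T hT
    rcases Finset.subset_singleton_iff.1 (hS T hT).2 with h' | h'
    · simp [h', Function.update_eq_self_iff]
    · simp [h', Function.update_eq_self_iff]

/-- A corner of `μ` without a right neighbour in `λ` may or may not contain the letter `1'`. -/
theorem sum_tabSign_zero_eq_zero (h : μ.Sub l) {i j : ℕ} (hμ : (i, j) ∈ μ.SD)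
    (hc : (i, j) ∉ interior μ.SD) (hr : (i, j + 1) ∉ l.SD) (hd : d → i ≠ j) :
    ∑ T ∈ letterTabs d l μ 0 1, tabSign l μ T = 0 := by
  classical
  have hl := sub_iff_SD_subset.1 h hμ
  refine sum_tabSign_eq_zero _ hl 0
    (fun T hT => ⟨(mem_letterTabs.1 hT).1.toIsShSVTQ, (mem_letterTabs_zero.1 hT).1 _⟩) ?_
  intro T hT s hs
  rw [mem_letterTabs_zero] at hT ⊢
  obtain ⟨h₁, h₂, h₃, h₄, h₅⟩ := hT
  have hup : ∀ b, b ≠ (i, j) → Function.update T (i, j) s b = T b := fun b hb =>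
    Function.update_of_ne hb _ _
  refine ⟨fun b => ?_, fun b hb => ?_, fun b hb => ?_, fun i' j' hp hq => ?_, fun hd' i' hp => ?_⟩
  · by_cases hb : b = (i, j)
    · rw [hb, Function.update_self]
      exact hs
    · rw [hup b hb]
      exact h₁ b
  · by_cases hb' : b = (i, j)
    · rw [hb', Finset.mem_sdiff]
      exact ⟨hl, hc⟩
    · rw [hup b hb'] at hb
      exact h₂ b hb
  · have hb' : b ≠ (i, j) := by
      rintro rfl
      exact (Finset.mem_sdiff.1 hb).2 hμ
    rw [hup b hb']
    exact h₃ b hb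
  · by_cases hb : (i', j') = (i, j)
    · obtain ⟨rfl, rfl⟩ := Prod.mk.inj hb
      rw [hup _ (by simp)] at hq
      exact hr (Finset.mem_sdiff.1 (h₂ _ hq)).1
    rw [hup _ hb] at hp
    by_cases hb' : (i', j' + 1) = (i, j)
    · -- the left neighbour of the corner is an interior box of `μ`
      obtain ⟨rfl, rfl⟩ := Prod.mk.inj hb'
      have hm := Finset.mem_sdiff.1 (h₂ _ hp)
      refine hm.2 ((mem_interior_SD _ _ _).2 ⟨?_, Or.inr hμ⟩)
      have := (mem_SD _ _ _).1 hm.1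
      rw [mem_SD] at hμ ⊢
      omega
    · rw [hup _ hb'] at hq
      exact h₄ i' j' hp hq
  · by_cases hb : (i', i') = (i, j)
    · obtain ⟨rfl, rfl⟩ := Prod.mk.inj hb
      exact hd hd' rfl
    · rw [hup _ hb] at hp
      exact h₅ hd' i' hp

/-- A corner of `μ` without a lower neighbour in `λ` may or may not contain the letter `1`. -/
theorem sum_tabSign_one_eq_zero (h : μ.Sub l) {i j : ℕ} (hμ : (i, j) ∈ μ.SD)
    (hc : (i, j) ∉ interior μ.SD) (hr : (i + 1, j) ∉ l.SD) :
    ∑ T ∈ letterTabs d l μ 1 2, tabSign l μ T = 0 := by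
  classical
  have hl := sub_iff_SD_subset.1 h hμ
  refine sum_tabSign_eq_zero _ hl 1
    (fun T hT => ⟨(mem_letterTabs.1 hT).1.toIsShSVTQ, (mem_letterTabs_one.1 hT).1 _⟩) ?_
  intro T hT s hs
  rw [mem_letterTabs_one] at hT ⊢
  obtain ⟨h₁, h₂, h₃, h₄⟩ := hT
  have hup : ∀ b, b ≠ (i, j) → Function.update T (i, j) s b = T b := fun b hb =>
    Function.update_of_ne hb _ _
  refine ⟨fun b => ?_, fun b hb => ?_, fun b hb => ?_, fun i' j' hp hq => ?_⟩
  · by_cases hb : b = (i, j)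
    · rw [hb, Function.update_self]
      exact hs
    · rw [hup b hb]
      exact h₁ b
  · by_cases hb' : b = (i, j)
    · rw [hb', Finset.mem_sdiff]
      exact ⟨hl, hc⟩
    · rw [hup b hb'] at hb
      exact h₂ b hb
  · have hb' : b ≠ (i, j) := by
      rintro rfl
      exact (Finset.mem_sdiff.1 hb).2 hμ
    rw [hup b hb']
    exact h₃ b hb
  · by_cases hb : (i', j') = (i, j)
    · obtain ⟨rfl, rfl⟩ := Prod.mk.inj hb
      rw [hup _ (by simp)] at hq
      exact hr (Finset.mem_sdiff.1 (h₂ _ hq)).1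
    rw [hup _ hb] at hp
    by_cases hb' : (i' + 1, j') = (i, j)
    · -- the upper neighbour of the corner is an interior box of `μ`
      obtain ⟨rfl, rfl⟩ := Prod.mk.inj hb'
      have hm := Finset.mem_sdiff.1 (h₂ _ hp)
      refine hm.2 ((mem_interior_SD _ _ _).2 ⟨?_, Or.inl hμ⟩)
      rw [mem_SD] at hμ ⊢
      have := μ.part_succ_lt (i := i') (by omega)
      omega
    · rw [hup _ hb'] at hq
      exact h₄ i' j' hp hq

open Classical in
/-- The filling that puts the letter `k` into the boxes of `λ / μ`. -/
def constFilling (l μ : StrictPartition) (k : ℕ) : Filling :=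
  fun b => if b ∈ l.SD \ μ.SD then {k} else ∅

theorem mem_constFilling {k p : ℕ} {b : ℕ × ℕ} :
    p ∈ constFilling l μ k b ↔ b ∈ l.SD \ μ.SD ∧ p = k := by
  rw [constFilling]
  split_ifs with h <;> simp [h]

theorem sum_tabSign_eq_one (S : Finset Filling) (k : ℕ)
    (hS : ∀ T ∈ S, IsShSVTQ l μ T ∧ ∀ b, T b ⊆ {k}) (hμ : ∀ T ∈ S, ∀ b ∈ μ.SD, k ∉ T b)
    (hconst : constFilling l μ k ∈ S) : ∑ T ∈ S, tabSign l μ T = 1 := by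
  classical
  have huniq : S = {constFilling l μ k} := by
    refine Finset.eq_singleton_iff_unique_mem.2 ⟨hconst, fun T hT => ?_⟩
    funext b
    ext p
    rw [mem_constFilling]
    constructor
    · intro hp
      obtain rfl : p = k := by simpa using (hS T hT).2 b hp
      exact ⟨Finset.mem_sdiff.2 ⟨(hS T hT).1.mem_SD hp, fun h => hμ T hT b h hp⟩, rfl⟩
    · rintro ⟨hb, rfl⟩
      obtain ⟨q, hq⟩ := (hS T hT).1.nonempty b hb
      obtain rfl : q = p := by simpa using (hS T hT).2 b hq
      exact hq
  have hsize : size l (constFilling l μ k) = (l.SD \ μ.SD).card := by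
    rw [size, Finset.card_eq_sum_ones, ← Finset.sum_filter_add_sum_filter_not _ (· ∈ μ.SD),
      Finset.sum_eq_zero, zero_add, ← Finset.sdiff_eq_filter]
    · exact Finset.sum_congr rfl fun b hb => by simp [constFilling, Finset.mem_sdiff.1 hb]
    · intro b hb
      simp [constFilling, (Finset.mem_filter.1 hb).2]
  rw [huniq, Finset.sum_singleton, tabSign, hsize, Nat.sub_self, pow_zero]

/-! ### The value of the series at `(1, 0, 0, …)` -/

namespace StrictPartition

/-- The strict partition obtained from `μ` by adding a box to each of its nonempty rows. -/
def inflate (μ : StrictPartition) : StrictPartition :=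
  ofSucc (fun i => if μ.part i = 0 then 0 else μ.part i + 1)
    (fun i hi => by
      have h : μ.part (i + 1) ≠ 0 := by
        intro h
        simp [h] at hi
      have := μ.part_succ_lt h
      rw [if_neg h, if_neg (by omega)]
      omega)
    (by
      obtain ⟨N, hN⟩ := μ.finite
      exact ⟨N, fun i hi => by simp [hN i hi]⟩)

theorem inflate_part (μ : StrictPartition) (i : ℕ) :
    μ.inflate.part i = if μ.part i = 0 then 0 else μ.part i + 1 := rfl

theorem sub_inflate (μ : StrictPartition) : μ.Sub μ.inflate := by
  intro i
  rw [inflate_part]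
  split_ifs <;> omega

theorem inflate_tail_sub (l : StrictPartition) : l.tail.inflate.Sub l := by
  intro i
  rw [inflate_part]
  split_ifs with h
  · omega
  · exact l.part_succ_lt h

end StrictPartition

/-- Cancellation leaves exactly one pair of a vertical strip of letters `1'` and a horizontal
strip of letters `1`. -/
theorem strip_rigidity {ρ : StrictPartition} (hμρ : μ.Sub ρ) (hρν : ρ.Sub ν)
    (h₁ : ∑ T ∈ letterTabs d ρ μ 0 1, tabSign ρ μ T ≠ 0)
    (h₂ : ∑ T ∈ letterTabs d ν ρ 1 2, tabSign ν ρ T ≠ 0) : ρ = μ.inflate ∧ ν.tail = μ := by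
  obtain ⟨T₁, hT₁, -⟩ := Finset.exists_ne_zero_of_sum_ne_zero h₁
  obtain ⟨T₂, hT₂, -⟩ := Finset.exists_ne_zero_of_sum_ne_zero h₂
  obtain ⟨-, -, hne₁, hrow, -⟩ := mem_letterTabs_zero.1 hT₁
  obtain ⟨-, -, hne₂, hcol⟩ := mem_letterTabs_one.1 hT₂
  -- rows of `ρ` of length one would end in a diagonal corner
  have hone : ∀ i, ρ.part i ≠ 1 := by
    intro i hi
    refine h₂ (sum_tabSign_one_eq_zero hρν (i := i) (j := i) ?_ ?_ ?_)
    · rw [mem_SD]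
      omega
    · rw [mem_interior_SD, mem_SD, mem_SD, mem_SD]
      omega
    · rw [mem_SD]
      omega
  have hle : ∀ i, ρ.part i ≤ μ.part i + 1 := by
    intro i
    by_contra hi
    refine hrow i (i + μ.part i) (hne₁ _ ?_) (hne₁ _ ?_) <;>
    · rw [Finset.mem_sdiff, mem_SD, mem_SD]
      omega
  have hρ : ∀ n i, μ.part i = n + 1 → ρ.part i = n + 2 := by
    intro n
    induction n with
    | zero =>
      intro i hi
      have := hone i
      have := hle i
      have := hμρ i
      omega
    | succ n ih =>
      intro i hi
      have hi₁ := hle i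
      have hi₂ := hμρ i
      by_contra hne
      by_cases hc : (i + 1, i + (n + 1)) ∈ μ.SD
      · -- then the next row is shorter by one, so it cannot grow either
        rw [mem_SD] at hc
        have h := μ.part_succ_lt (i := i) (by omega)
        have := ih (i + 1) (by omega)
        have := ρ.part_succ_lt (i := i) (by omega)
        omega
      · refine h₁ (sum_tabSign_zero_eq_zero hμρ (i := i) (j := i + (n + 1)) ?_ ?_ ?_ ?_)
        · rw [mem_SD]
          omega
        · rw [mem_interior_SD]
          rintro ⟨-, h | h⟩
          · exact hc h
          · rw [mem_SD] at h
            omega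
        · rw [mem_SD]
          omega
        · omega
  have hρ' : ∀ i, ρ.part i = if μ.part i = 0 then 0 else μ.part i + 1 := by
    intro i
    split_ifs with h
    · have := hone i
      have := hle i
      omega
    · have := hρ (μ.part i - 1) i (by omega)
      omega
  refine ⟨StrictPartition.ext (funext fun i => ?_), StrictPartition.ext (funext fun i => ?_)⟩
  · rw [hρ', inflate_part]
  change ν.part (i + 1) = μ.part i
  have hi := hρ' i
  refine le_antisymm ?_ ?_
  · by_contra hlt
    have hs := ν.part_succ_lt (i := i) (by omega)
    -- the last box of row `i + 1` of `ν` would have an upper neighbour in `ν / ρ`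
    have hi' := hρ' (i + 1)
    have hμs : μ.part (i + 1) ≤ μ.part i := μ.tail_sub i
    refine hcol i (i + ν.part (i + 1)) (hne₂ _ ?_) (hne₂ _ ?_)
    · rw [Finset.mem_sdiff, mem_SD, mem_SD]
      split_ifs at hi <;> omega
    · rw [Finset.mem_sdiff, mem_SD, mem_SD]
      by_cases h0 : μ.part (i + 1) = 0
      · rw [if_pos h0] at hi'
        omega
      · have := μ.part_succ_lt h0
        rw [if_neg h0] at hi'
        omega
  · by_contra hlt
    have h0 : μ.part i ≠ 0 := by omega
    rw [if_neg h0] at hi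
    have hbelow : (i + 1, i + μ.part i) ∉ ν.SD := by
      rw [mem_SD]
      omega
    refine h₂ (sum_tabSign_one_eq_zero hρν (i := i) (j := i + μ.part i) ?_ ?_ hbelow)
    · rw [mem_SD]
      omega
    · rw [mem_interior_SD]
      rintro ⟨-, h | h⟩
      · exact hbelow (sub_iff_SD_subset.1 hρν h)
      · rw [mem_SD] at h
        omega

theorem sum_tabSign_inflate (d : Prop) (μ : StrictPartition) :
    ∑ T ∈ letterTabs d μ.inflate μ 0 1, tabSign μ.inflate μ T = 1 := by
  have hnew : ∀ i j, (i, j) ∈ μ.inflate.SD \ μ.SD ↔ μ.part i ≠ 0 ∧ j = i + μ.part i := by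
    intro i j
    rw [Finset.mem_sdiff, mem_SD, mem_SD, inflate_part]
    split_ifs <;> omega
  refine sum_tabSign_eq_one _ 0
    (fun T hT => ⟨(mem_letterTabs.1 hT).1.toIsShSVTQ, (mem_letterTabs_zero.1 hT).1⟩) ?_ ?_
  · rintro T hT ⟨i, j⟩ hb h0
    obtain ⟨-, hsupp, hne, hrow, -⟩ := mem_letterTabs_zero.1 hT
    have hc := (Finset.mem_sdiff.1 (hsupp _ h0)).2
    rw [mem_interior_SD] at hc
    refine hrow i j h0 (hne _ ?_)
    have hr : (i, j + 1) ∉ μ.SD := fun h => hc ⟨hb, Or.inr h⟩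
    rw [hnew]
    rw [mem_SD] at hb hr
    omega
  · rw [mem_letterTabs_zero]
    refine ⟨fun b k hk => ?_, fun b hb => ?_, fun b hb => mem_constFilling.2 ⟨hb, rfl⟩,
      fun i j h h' => ?_,
      fun _ i h => ?_⟩
    · simpa using (mem_constFilling.1 hk).2
    · have := Finset.mem_sdiff.1 (mem_constFilling.1 hb).1
      exact Finset.mem_sdiff.2 ⟨this.1, fun h => this.2 (interior_subset _ h)⟩
    · have h₁ := (hnew _ _).1 (mem_constFilling.1 h).1
      have h₂ := (hnew _ _).1 (mem_constFilling.1 h').1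
      omega
    · have := (hnew _ _).1 (mem_constFilling.1 h).1
      omega

theorem sum_tabSign_tail (d : Prop) (ν : StrictPartition) :
    ∑ T ∈ letterTabs d ν ν.tail.inflate 1 2, tabSign ν ν.tail.inflate T = 1 := by
  have hpart : ∀ i, ν.tail.inflate.part i = if ν.part (i + 1) = 0 then 0 else ν.part (i + 1) + 1 :=
    fun i => rfl
  refine sum_tabSign_eq_one _ 1
    (fun T hT => ⟨(mem_letterTabs.1 hT).1.toIsShSVTQ, (mem_letterTabs_one.1 hT).1⟩) ?_ ?_
  · rintro T hT ⟨i, j⟩ hb h0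
    obtain ⟨-, hsupp, hne, hcol⟩ := mem_letterTabs_one.1 hT
    have hc := (Finset.mem_sdiff.1 (hsupp _ h0)).2
    rw [mem_interior_SD] at hc
    refine hcol i j h0 (hne _ ?_)
    have hr : (i, j + 1) ∉ ν.tail.inflate.SD := fun h => hc ⟨hb, Or.inr h⟩
    rw [Finset.mem_sdiff]
    refine ⟨?_, fun h => hc ⟨hb, Or.inl h⟩⟩
    rw [mem_SD, hpart] at hb hr
    rw [mem_SD]
    split_ifs at hb hr <;> omega
  · rw [mem_letterTabs_one]
    refine ⟨fun b k hk => ?_, fun b hb => ?_, fun b hb => mem_constFilling.2 ⟨hb, rfl⟩,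
      fun i j h h' => ?_⟩
    · simpa using (mem_constFilling.1 hk).2
    · have := Finset.mem_sdiff.1 (mem_constFilling.1 hb).1
      exact Finset.mem_sdiff.2 ⟨this.1, fun h => this.2 (interior_subset _ h)⟩
    · have h₁ := Finset.mem_sdiff.1 (mem_constFilling.1 h).1
      have h₂ := (Finset.mem_sdiff.1 (mem_constFilling.1 h').1).1
      rw [mem_SD, mem_SD, hpart] at h₁
      rw [mem_SD] at h₂
      have := h₁.2
      split_ifs at this <;> omega

theorem sum_tabSign_letters_lt_two (d : Prop) (h : μ.Sub ν) [Decidable (ν.tail = μ)] :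
    ∑ T ∈ letterTabs d ν μ 0 2, tabSign ν μ T = if ν.tail = μ then 1 else 0 := by
  classical
  have key := sum_tabSign_cut d h (show 1 ≤ 2 by norm_num) fun _ _ => 1
  simp only [mul_one] at key
  rw [key]
  simp_rw [← Finset.sum_mul_sum]
  split_ifs with hν
  · subst hν
    rw [Finset.sum_eq_single ν.tail.inflate, sum_tabSign_inflate, sum_tabSign_tail, mul_one]
    · intro ρ hρ hne
      rw [mem_between] at hρ
      by_contra hmul
      exact hne (strip_rigidity hρ.1 hρ.2 (left_ne_zero_of_mul hmul)
        (right_ne_zero_of_mul hmul)).1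
    · intro hρ
      exact absurd (mem_between.2 ⟨sub_inflate _, inflate_tail_sub _⟩) hρ
  · refine Finset.sum_eq_zero fun ρ hρ => ?_
    rw [mem_between] at hρ
    by_contra hmul
    exact hν (strip_rigidity hρ.1 hρ.2 (left_ne_zero_of_mul hmul)
      (right_ne_zero_of_mul hmul)).2

/-- The value of `G_{ν // μ}` at `(1, 0, 0, …)` is `1` if `μ` is `ν` without its first part,
and `0` otherwise. -/
theorem finsum_coeff_tabSeries (d : Prop) (h : μ.Sub ν) [Decidable (ν.tail = μ)] :
    ∑ᶠ n, MvPowerSeries.coeff (Finsupp.single 0 n) (tabSeries d ν μ) =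
      if ν.tail = μ then 1 else 0 := by
  classical
  have hcoeff : ∀ n, MvPowerSeries.coeff (Finsupp.single 0 n) (tabSeries d ν μ) =
      ∑ T ∈ letterTabs d ν μ 0 2,
        if weight ν T = Finsupp.single 0 n then tabSign ν μ T else 0 := by
    intro n
    refine coeff_tabSeries d h fun i hi => ?_
    have := Finset.mem_singleton.1 (Finsupp.support_single_subset hi)
    omega
  have hone : ∀ T ∈ letterTabs d ν μ 0 2, ∀ n,
      (weight ν T = Finsupp.single 0 n ↔ n = weight ν T 0) := by
    intro T hT n
    constructor
    · intro hw
      rw [hw, Finsupp.single_eq_same]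
    · rintro rfl
      ext i
      by_cases hi : i = 0
      · rw [hi, Finsupp.single_eq_same]
      · rw [Finsupp.single_eq_of_ne hi, ← Finsupp.notMem_support_iff]
        intro hi'
        rw [mem_letterTabs] at hT
        obtain ⟨b, k, hk, hki⟩ := (hT.1.mem_support_weight_iff i).1 hi'
        have := (hT.2 b k hk).2
        omega
  rw [← sum_tabSign_letters_lt_two d h, finsum_congr hcoeff, finsum_sum_comm]
  · refine Finset.sum_congr rfl fun T hT => ?_
    rw [finsum_eq_single _ (weight ν T 0) fun n hn => if_neg fun hw => hn ((hone T hT n).1 hw),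
      if_pos ((hone T hT _).2 rfl)]
  · intro T hT
    refine (Set.finite_singleton (weight ν T 0)).subset fun n hn => ?_
    rw [Function.mem_support] at hn
    by_contra hne
    exact hn (if_neg fun hw => hne ((hone T hT n).1 hw))

/-! ### Removing the first row -/

namespace StrictPartition

/-- The least possible first part of a strict partition `ν` with `(ν₂, ν₃, …) = μ`. -/
def leastHead (μ : StrictPartition) : ℕ := if μ.part 0 = 0 then 0 else μ.part 0 + 1

/-- The strict partition `(k, μ₁, μ₂, …)` where `k` exceeds its least possible value by `n`. -/
def prepend (μ : StrictPartition) (n : ℕ) : StrictPartition :=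
  ofSucc (fun i => Nat.casesOn i (μ.leastHead + n) μ.part)
    (fun i hi => by
      cases i with
      | zero =>
        change μ.part 0 ≠ 0 at hi
        change μ.part 0 < μ.leastHead + n
        rw [leastHead, if_neg hi]
        omega
      | succ i => exact μ.part_succ_lt hi)
    (by
      obtain ⟨N, hN⟩ := μ.finite
      refine ⟨N + 1, fun i hi => ?_⟩
      cases i with
      | zero => omega
      | succ i => exact hN i (by omega))

theorem prepend_part_zero (μ : StrictPartition) (n : ℕ) :
    (μ.prepend n).part 0 = μ.leastHead + n := rfl

theorem prepend_part_succ (μ : StrictPartition) (n i : ℕ) :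
    (μ.prepend n).part (i + 1) = μ.part i := rfl

theorem tail_prepend (μ : StrictPartition) (n : ℕ) : (μ.prepend n).tail = μ := rfl

theorem leastHead_tail_le (ν : StrictPartition) : ν.tail.leastHead ≤ ν.part 0 := by
  rw [leastHead]
  split_ifs with h
  · omega
  · exact ν.part_succ_lt h

theorem prepend_tail (ν : StrictPartition) :
    ν.tail.prepend (ν.part 0 - ν.tail.leastHead) = ν := by
  have := ν.leastHead_tail_le
  ext i
  cases i with
  | zero =>
    rw [prepend_part_zero]
    omega
  | succ i => rfl

theorem leastHead_mono (h : μ.Sub l) : μ.leastHead ≤ l.leastHead := by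
  have := h 0
  rw [leastHead, leastHead]
  split_ifs <;> omega

theorem prepend_sub_iff (h : μ.Sub l.tail) (n : ℕ) :
    (μ.prepend n).Sub l ↔ μ.leastHead + n ≤ l.part 0 := by
  refine ⟨fun h' => h' 0, fun h' i => ?_⟩
  cases i with
  | zero => exact h'
  | succ i => exact h i

theorem prepend_mono (μ : StrictPartition) (n : ℕ) : (μ.prepend n).Sub (μ.prepend (n + 1)) := by
  intro i
  cases i with
  | zero =>
    rw [prepend_part_zero, prepend_part_zero]
    omega
  | succ i => exact le_rfl

end StrictPartition

theorem succ_succ_mem_SD (l : StrictPartition) (i j : ℕ) :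
    (i + 1, j + 1) ∈ l.SD ↔ (i, j) ∈ l.tail.SD := by
  rw [mem_SD, mem_SD]
  change _ ↔ i ≤ j ∧ j < i + l.part (i + 1)
  omega

theorem succ_succ_mem_interior (l : StrictPartition) (i j : ℕ) :
    (i + 1, j + 1) ∈ interior l.SD ↔ (i, j) ∈ interior l.tail.SD := by
  simp only [mem_interior_SD, succ_succ_mem_SD]

theorem succ_zero_notMem_SD (l : StrictPartition) (i : ℕ) : (i + 1, 0) ∉ l.SD := by
  rw [mem_SD]
  omega

/-- The filling moved by one step along the diagonal. -/
def pushDown (T : Filling) : ℕ × ℕ → Finset ℕ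
  | (i + 1, j + 1) => T (i, j)
  | _ => ∅

theorem sum_pushDown {M : Type*} [AddCommMonoid M] (l : StrictPartition) (T : Filling)
    (f : Finset ℕ → M) (hf : f ∅ = 0) :
    ∑ b ∈ l.SD, f (pushDown T b) = ∑ b ∈ l.tail.SD, f (T b) := by
  symm
  refine Finset.sum_bij_ne_zero (fun b _ _ => (b.1 + 1, b.2 + 1)) ?_ ?_ ?_ ?_
  · rintro ⟨i, j⟩ hb -
    exact (succ_succ_mem_SD l i j).2 hb
  · rintro ⟨i, j⟩ - - ⟨i', j'⟩ - - h
    simpa using h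
  · rintro ⟨_ | i, _ | j⟩ hb h
    · exact absurd hf h
    · exact absurd hf h
    · exact absurd hf h
    · exact ⟨(i, j), (succ_succ_mem_SD l i j).1 hb, h, rfl⟩
  · exact fun _ _ _ => rfl

theorem isTab_pushDown_iff (h : ν.part 0 = l.part 0) :
    IsTab d l ν (pushDown T) ↔ IsTab d l.tail ν.tail T := by
  constructor
  · intro hT
    refine ⟨⟨?_, ?_, fun i j => hT.row_le (i + 1) (j + 1), fun i j => hT.col_le (i + 1) (j + 1),
      fun i j => hT.row_inter (i + 1) (j + 1), fun i j => hT.col_inter (i + 1) (j + 1)⟩,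
      fun hd i => hT.diag hd (i + 1)⟩
    · rintro ⟨i, j⟩ hb
      refine hT.support (i + 1, j + 1) ?_
      rwa [Finset.mem_sdiff, succ_succ_mem_SD, succ_succ_mem_interior, ← Finset.mem_sdiff]
    · rintro ⟨i, j⟩ hb
      refine hT.nonempty (i + 1, j + 1) ?_
      rwa [Finset.mem_sdiff, succ_succ_mem_SD, succ_succ_mem_SD, ← Finset.mem_sdiff]
  · intro hT
    refine ⟨⟨?_, ?_, ?_, ?_, ?_, ?_⟩, ?_⟩
    · rintro ⟨_ | i, _ | j⟩ hb
      · rfl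
      · rfl
      · rfl
      · refine hT.support (i, j) ?_
        rwa [Finset.mem_sdiff, succ_succ_mem_SD, succ_succ_mem_interior, ← Finset.mem_sdiff] at hb
    · rintro ⟨i, j⟩ hb
      have hb' := Finset.mem_sdiff.1 hb
      cases i with
      | zero =>
        rw [mem_SD, mem_SD] at hb'
        omega
      | succ i =>
        cases j with
        | zero => exact absurd hb'.1 (succ_zero_notMem_SD l i)
        | succ j =>
          rw [succ_succ_mem_SD, succ_succ_mem_SD, ← Finset.mem_sdiff] at hb'
          exact hT.nonempty (i, j) hb'
    · rintro (_ | i) (_ | j) p hp q hq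
      · simp [pushDown] at hp
      · simp [pushDown] at hp
      · simp [pushDown] at hp
      · exact hT.row_le i j p hp q hq
    · rintro (_ | i) (_ | j) p hp q hq
      · simp [pushDown] at hp
      · simp [pushDown] at hp
      · simp [pushDown] at hp
      · exact hT.col_le i j p hp q hq
    · rintro (_ | i) (_ | j) p hp
      · simp [pushDown] at hp
      · simp [pushDown] at hp
      · simp [pushDown] at hp
      · exact hT.row_inter i j p hp
    · rintro (_ | i) (_ | j) p hp
      · simp [pushDown] at hp
      · simp [pushDown] at hp
      · simp [pushDown] at hp
      · exact hT.col_inter i j p hp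
    · rintro hd (_ | i) p hp
      · simp [pushDown] at hp
      · exact hT.diag hd i p hp

theorem card_skew_tail (h : ν.part 0 = l.part 0) :
    (l.tail.SD \ ν.tail.SD).card = (l.SD \ ν.SD).card := by
  refine Finset.card_bij (fun b _ => (b.1 + 1, b.2 + 1)) ?_ ?_ ?_
  · rintro ⟨i, j⟩ hb
    rwa [Finset.mem_sdiff, succ_succ_mem_SD, succ_succ_mem_SD, ← Finset.mem_sdiff]
  · rintro ⟨i, j⟩ - ⟨i', j'⟩ - h
    simpa using h
  · rintro ⟨i, j⟩ hb
    have hb' := Finset.mem_sdiff.1 hb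
    cases i with
    | zero =>
      rw [mem_SD, mem_SD] at hb'
      omega
    | succ i =>
      cases j with
      | zero => exact absurd hb'.1 (succ_zero_notMem_SD l i)
      | succ j =>
        rw [succ_succ_mem_SD, succ_succ_mem_SD, ← Finset.mem_sdiff] at hb'
        exact ⟨(i, j), hb', rfl⟩

open Classical in
/-- The tableaux of shape `λ // ν`, with letters `< hi`, that have no letters in the boxes of the
first row of `ν`. -/
def rowFreeTabs (d : Prop) (l ν : StrictPartition) (hi : ℕ) : Finset Filling :=
  (letterTabs d l ν 0 hi).filter fun T => ∀ j < ν.part 0, T (0, j) = ∅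

/-- The contribution of the tableaux in `rowFreeTabs` to the coefficient of `x^m`. -/
def rowFreeCoeff (d : Prop) (l ν : StrictPartition) (hi : ℕ) (m : ℕ →₀ ℕ) : ℝ :=
  ∑ T ∈ rowFreeTabs d l ν hi, if weight l T = m then tabSign l ν T else 0

/-- If `ν` has the same first row as `λ`, the first rows may be dropped. -/
theorem rowFreeCoeff_eq_coeff_tail (d : Prop) (hν : ν.part 0 = l.part 0)
    (h : ν.tail.Sub l.tail) {m : ℕ →₀ ℕ} {hi : ℕ} (hm : ∀ i ∈ m.support, 2 * i + 2 ≤ hi) :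
    rowFreeCoeff d l ν hi m = MvPowerSeries.coeff m (tabSeries d l.tail ν.tail) := by
  classical
  rw [coeff_tabSeries d h hm, rowFreeCoeff]
  symm
  refine Finset.sum_bij (fun T _ => pushDown T) ?_ ?_ ?_ ?_
  · intro T hT
    rw [mem_letterTabs] at hT
    rw [rowFreeTabs, Finset.mem_filter, mem_letterTabs, isTab_pushDown_iff hν]
    refine ⟨⟨hT.1, ?_⟩, fun j _ => rfl⟩
    rintro ⟨_ | i, _ | j⟩ k hk
    · simp [pushDown] at hk
    · simp [pushDown] at hk
    · simp [pushDown] at hk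
    · exact hT.2 (i, j) k hk
  · intro T _ T' _ heq
    funext ⟨i, j⟩
    exact congrFun heq (i + 1, j + 1)
  · intro T hT
    rw [rowFreeTabs, Finset.mem_filter, mem_letterTabs] at hT
    obtain ⟨⟨hT, hk⟩, hrow⟩ := hT
    have hpush : pushDown (fun b => T (b.1 + 1, b.2 + 1)) = T := by
      funext ⟨i, j⟩
      cases i with
      | zero =>
        change ∅ = T (0, j)
        by_cases hj : j < ν.part 0
        · exact (hrow j hj).symm
        · refine (hT.support _ fun hb => ?_).symm
          have := (mem_SD _ _ _).1 (Finset.mem_sdiff.1 hb).1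
          omega
      | succ i =>
        cases j with
        | zero =>
          exact (hT.support _ fun hb => succ_zero_notMem_SD l i (Finset.mem_sdiff.1 hb).1).symm
        | succ j => rfl
    refine ⟨fun b => T (b.1 + 1, b.2 + 1), ?_, hpush⟩
    rw [mem_letterTabs]
    exact ⟨(isTab_pushDown_iff hν).1 (hpush.symm ▸ hT), fun b => hk (b.1 + 1, b.2 + 1)⟩
  · intro T _
    have e₁ : weight l (pushDown T) = weight l.tail T :=
      sum_pushDown l T (fun s => ∑ k ∈ s, Finsupp.single (k / 2) 1) Finset.sum_empty
    have e₂ : size l (pushDown T) = size l.tail T :=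
      sum_pushDown l T Finset.card Finset.card_empty
    rw [e₁, tabSign, tabSign, e₂, card_skew_tail hν]

theorem IsTab.of_shape (hT : IsTab d l μ T) (h₁ : ∀ b ∈ interior ν.SD, T b = ∅)
    (h₂ : ∀ b ∈ l.SD \ ν.SD, (T b).Nonempty) : IsTab d l ν T := by
  refine ⟨⟨fun b hb => ?_, h₂, hT.row_le, hT.col_le, hT.row_inter, hT.col_inter⟩, hT.diag⟩
  by_cases hl : b ∈ l.SD
  · refine h₁ b ?_
    by_contra h
    exact hb (Finset.mem_sdiff.2 ⟨hl, h⟩)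
  · exact hT.support b fun h => hl (Finset.mem_sdiff.1 h).1

/-- If the first part of `ν` is the least possible, its first row lies in the interior. -/
theorem coeff_tabSeries_prepend_zero (d : Prop) (hl : (μ.prepend 0).Sub l) {m : ℕ →₀ ℕ} {hi : ℕ}
    (hm : ∀ i ∈ m.support, 2 * i + 2 ≤ hi) :
    MvPowerSeries.coeff m (tabSeries d l (μ.prepend 0)) =
      rowFreeCoeff d l (μ.prepend 0) hi m := by
  classical
  rw [coeff_tabSeries d hl hm, rowFreeCoeff, rowFreeTabs, Finset.filter_true_of_mem]
  intro T hT j hj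
  rw [mem_letterTabs] at hT
  refine hT.1.support _ fun hb => (Finset.mem_sdiff.1 hb).2 ?_
  rw [prepend_part_zero, leastHead] at hj
  rw [mem_interior_SD, mem_SD, mem_SD, mem_SD, prepend_part_zero, prepend_part_succ, leastHead]
  split_ifs at hj ⊢ <;> omega

/-- If the first part of `ν` is larger, the last box of the first row of `ν` is a corner; the
tableaux in which it is nonempty are, up to a sign, those for the next smaller `ν` that avoid the
first row of `ν`. -/
theorem coeff_tabSeries_prepend_succ (d : Prop) (n : ℕ) (hl : (μ.prepend (n + 1)).Sub l)
    {m : ℕ →₀ ℕ} {hi : ℕ} (hm : ∀ i ∈ m.support, 2 * i + 2 ≤ hi) :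
    MvPowerSeries.coeff m (tabSeries d l (μ.prepend (n + 1))) =
      rowFreeCoeff d l (μ.prepend (n + 1)) hi m - rowFreeCoeff d l (μ.prepend n) hi m := by
  classical
  have hSD := sub_iff_SD_subset.1 (prepend_mono μ n)
  have hhead : μ.leastHead + n < l.part 0 := hl 0
  -- boxes of the first row before the corner are interior
  have hint : ∀ j < μ.leastHead + n, (0, j) ∈ interior (μ.prepend (n + 1)).SD := by
    intro j hj
    rw [mem_interior_SD, mem_SD, mem_SD, mem_SD, prepend_part_zero]
    omega
  have hcorner : ∀ i j, (i, j) ∈ interior (μ.prepend (n + 1)).SD →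
      (i, j) ∈ interior (μ.prepend n).SD ∨ i = 0 ∧ j < μ.leastHead + n := by
    intro i j hb
    cases i with
    | zero =>
      rw [mem_interior_SD, mem_SD, mem_SD, mem_SD, prepend_part_zero, prepend_part_succ] at hb
      have : μ.part 0 = 0 ∨ μ.part 0 < μ.leastHead := by
        rw [leastHead]
        split_ifs <;> omega
      omega
    | succ i =>
      left
      rw [mem_interior_SD, mem_SD, mem_SD, mem_SD] at hb ⊢
      exact hb
  have hnew : ∀ b, b ∈ (μ.prepend (n + 1)).SD \ (μ.prepend n).SD ↔ b = (0, μ.leastHead + n) := by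
    rintro ⟨i, j⟩
    rw [Finset.mem_sdiff, mem_SD, mem_SD, Prod.mk.injEq]
    cases i with
    | zero =>
      rw [prepend_part_zero, prepend_part_zero]
      omega
    | succ i =>
      rw [prepend_part_succ, prepend_part_succ]
      omega
  have h₁ : (letterTabs d l (μ.prepend (n + 1)) 0 hi).filter
      (fun T => T (0, μ.leastHead + n) = ∅) = rowFreeTabs d l (μ.prepend (n + 1)) hi := by
    refine Finset.filter_congr fun T hT => ⟨fun h0 j hj => ?_, fun h => h _ ?_⟩
    · rw [mem_letterTabs] at hT
      rw [prepend_part_zero] at hj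
      by_cases hj' : j = μ.leastHead + n
      · rw [hj', h0]
      · exact hT.1.support _ fun hb => (Finset.mem_sdiff.1 hb).2 (hint j (by omega))
    · rw [prepend_part_zero]
      omega
  have h₂ : (letterTabs d l (μ.prepend (n + 1)) 0 hi).filter
      (fun T => ¬ T (0, μ.leastHead + n) = ∅) = rowFreeTabs d l (μ.prepend n) hi := by
    ext T
    rw [rowFreeTabs, Finset.mem_filter, Finset.mem_filter, mem_letterTabs, mem_letterTabs]
    constructor
    · rintro ⟨⟨hT, hk⟩, hne⟩
      have hempty : ∀ b ∈ interior (μ.prepend (n + 1)).SD, T b = ∅ := fun b hb =>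
        hT.support b fun h => (Finset.mem_sdiff.1 h).2 hb
      refine ⟨⟨hT.of_shape (fun b hb => hempty b (interior_mono hSD hb)) fun b hb => ?_, hk⟩,
        fun j hj => hempty _ (hint j hj)⟩
      rw [Finset.mem_sdiff] at hb
      by_cases hb' : b ∈ (μ.prepend (n + 1)).SD
      · obtain rfl := (hnew b).1 (Finset.mem_sdiff.2 ⟨hb', hb.2⟩)
        exact Finset.nonempty_iff_ne_empty.2 hne
      · exact hT.nonempty b (Finset.mem_sdiff.2 ⟨hb.1, hb'⟩)
    · rintro ⟨⟨hT, hk⟩, hrow⟩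
      refine ⟨⟨hT.of_shape ?_ fun b hb => hT.nonempty b ?_, hk⟩, ?_⟩
      · rintro ⟨i, j⟩ hb
        rcases hcorner i j hb with hb' | ⟨rfl, hj⟩
        · exact hT.support _ fun h => (Finset.mem_sdiff.1 h).2 hb'
        · exact hrow j hj
      · rw [Finset.mem_sdiff] at hb ⊢
        exact ⟨hb.1, fun h => hb.2 (hSD h)⟩
      · rw [← ne_eq, ← Finset.nonempty_iff_ne_empty]
        refine hT.nonempty _ ?_
        rw [Finset.mem_sdiff, mem_SD, mem_SD, prepend_part_zero]
        omega
  rw [coeff_tabSeries d hl hm,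
    ← Finset.sum_filter_add_sum_filter_not _ (fun T => T (0, μ.leastHead + n) = ∅), h₁, h₂,
    rowFreeCoeff, rowFreeCoeff, sub_eq_add_neg, ← Finset.sum_neg_distrib]
  congr 1
  refine Finset.sum_congr rfl fun T hT => ?_
  have hT' := hT
  rw [← h₂] at hT'
  rw [rowFreeTabs, Finset.mem_filter, mem_letterTabs] at hT
  rw [Finset.mem_filter, mem_letterTabs] at hT'
  have hcard : (l.SD \ (μ.prepend n).SD).card = 1 + (l.SD \ (μ.prepend (n + 1)).SD).card := by
    rw [card_skew_add (prepend_mono μ n) hl]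
    congr 1
    rw [Finset.card_eq_one]
    exact ⟨_, Finset.ext fun b => by rw [hnew, Finset.mem_singleton]⟩
  rw [tabSign_eq hT.1.1.toIsShSVTQ, tabSign_eq hT'.1.1.toIsShSVTQ, hcard, pow_add]
  split_ifs <;> simp

/-- Telescoping over the first part `k` gives `∑_k G_{λ // (k, μ)} = G_{(λ₂, λ₃, …) // μ}`. -/
theorem sum_coeff_tabSeries_of_tail (d : Prop) (l μ : StrictPartition) (m : ℕ →₀ ℕ)
    [DecidablePred fun ν : StrictPartition => ν.tail = μ] :
    ∑ ν ∈ between μ l with ν.tail = μ, MvPowerSeries.coeff m (tabSeries d l ν) =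
      MvPowerSeries.coeff m (tabSeries d l.tail μ) := by
  by_cases h : μ.Sub l.tail
  swap
  · rw [tabSeries_of_not_sub d h, map_zero]
    refine Finset.sum_eq_zero fun ν hν => absurd (fun i => ?_) h
    obtain ⟨hν, rfl⟩ := Finset.mem_filter.1 hν
    exact (mem_between.1 hν).2 (i + 1)
  have hle : μ.leastHead ≤ l.part 0 := (leastHead_mono h).trans l.leastHead_tail_le
  set hi := m.support.sup (fun i => 2 * i + 2) with hhi
  have hm : ∀ i ∈ m.support, 2 * i + 2 ≤ hi := fun i hi =>
    Finset.le_sup (f := fun i => 2 * i + 2) hi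
  have htel : ∀ n, (μ.prepend n).Sub l →
      ∑ k ∈ Finset.range (n + 1), MvPowerSeries.coeff m (tabSeries d l (μ.prepend k)) =
        rowFreeCoeff d l (μ.prepend n) hi m := by
    intro n
    induction n with
    | zero =>
      intro hn
      rw [zero_add, Finset.sum_range_one, coeff_tabSeries_prepend_zero d hn hm]
    | succ n ih =>
      intro hn
      rw [Finset.sum_range_succ, ih ((prepend_mono μ n).trans hn),
        coeff_tabSeries_prepend_succ d n hn hm]
      ring
  have hhead : (μ.prepend (l.part 0 - μ.leastHead)).part 0 = l.part 0 := by
    rw [prepend_part_zero]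
    omega
  have key := htel (l.part 0 - μ.leastHead) ((prepend_sub_iff h _).2 (by omega))
  rw [rowFreeCoeff_eq_coeff_tail d hhead h hm, tail_prepend] at key
  rw [← key]
  symm
  refine Finset.sum_bij (fun n _ => μ.prepend n) ?_ ?_ ?_ fun _ _ => rfl
  · intro n hn
    rw [Finset.mem_range] at hn
    have hsub : (μ.prepend n).Sub l := (prepend_sub_iff h n).2 (by omega)
    exact Finset.mem_filter.2 ⟨mem_between.2 ⟨tail_sub (μ.prepend n), hsub⟩, tail_prepend μ n⟩
  · intro n _ n' _ heq
    have := congrArg (fun κ : StrictPartition => κ.part 0) heq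
    simp only [prepend_part_zero] at this
    omega
  · intro ν hν
    obtain ⟨hν, rfl⟩ := Finset.mem_filter.1 hν
    have h₁ := (mem_between.1 hν).2 0
    refine ⟨ν.part 0 - ν.tail.leastHead, Finset.mem_range.2 ?_, prepend_tail ν⟩
    omega

/-- The series `f(1, x₁, x₂, …)`, for series `f` that are polynomials in the first variable. -/
def substOne (f : MvPowerSeries ℕ ℝ) : MvPowerSeries ℕ ℝ :=
  fun b => ∑ᶠ n, MvPowerSeries.coeff (Finsupp.single 0 n + b.mapDomain (· + 1)) f

theorem coeff_substOne (b : ℕ →₀ ℕ) (f : MvPowerSeries ℕ ℝ) :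
    MvPowerSeries.coeff b (substOne f) =
      ∑ᶠ n, MvPowerSeries.coeff (Finsupp.single 0 n + b.mapDomain (· + 1)) f := rfl

theorem finite_support_coeffOne {f : MvPowerSeries ℕ ℝ} (hf : f ∈ polyOne) :
    (Function.support fun n => coeffOne n f).Finite := by
  obtain ⟨p, hp⟩ := hf
  refine p.support.finite_toSet.subset fun n hn => ?_
  rw [Function.mem_support, hp n] at hn
  exact Polynomial.mem_support_iff.2 hn

/-- Setting the first variable to `1` removes the first part of `λ`. -/
theorem substOne_tabSeries (d : Prop) (l μ : StrictPartition) :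
    substOne (tabSeries d l μ) = tabSeries d l.tail μ := by
  classical
  ext b
  rw [coeff_substOne]
  by_cases h : μ.Sub l
  swap
  · rw [tabSeries_of_not_sub d h, tabSeries_of_not_sub d fun h' => h (h'.trans (tail_sub l))]
    simp
  have hfin : ∀ ν, (Function.support fun n =>
      MvPowerSeries.coeff (Finsupp.single 0 n) (tabSeries d ν μ)).Finite := fun ν =>
    finite_support_coeffOne (tableauSeries_mem_polyOne _ _ _ _)
  have hcut : ∀ n, MvPowerSeries.coeff (Finsupp.single 0 n + b.mapDomain (· + 1))
      (tabSeries d l μ) = ∑ ν ∈ between μ l,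
        MvPowerSeries.coeff (Finsupp.single 0 n) (tabSeries d ν μ) *
          MvPowerSeries.coeff b (tabSeries d l ν) := by
    intro n
    refine coeff_add_tabSeries d h 1 _ b fun i hi => ?_
    have := Finset.mem_singleton.1 (Finsupp.support_single_subset hi)
    omega
  rw [finsum_congr hcut, finsum_sum_comm, ← sum_coeff_tabSeries_of_tail, Finset.sum_filter]
  · refine Finset.sum_congr rfl fun ν hν => ?_
    rw [mem_between] at hν
    rw [← finsum_mul, finsum_coeff_tabSeries d hν.1, ite_mul, one_mul, zero_mul]
  · intro ν _
    exact (hfin ν).subset (Function.support_mul_subset_left _ _)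

/-! ### The coproduct -/

section Coproduct

open Finset.HasAntidiagonal (antidiagonal mem_antidiagonal)

variable {A : Subalgebra ℝ (MvPowerSeries ℕ ℝ)}

theorem pairCoeff_tmul (a b : ℕ →₀ ℕ) (f g : A) :
    pairCoeff A a b (f ⊗ₜ[ℝ] g) = MvPowerSeries.coeff a (f : MvPowerSeries ℕ ℝ) *
      MvPowerSeries.coeff b (g : MvPowerSeries ℕ ℝ) := by
  simp [pairCoeff]

/-- The map `p ⊗ q ↦ p(x) q(y)` is injective. -/
theorem eq_of_pairCoeff_eq {s t : A ⊗[ℝ] A} (h : ∀ a b, pairCoeff A a b s = pairCoeff A a b t) :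
    s = t := by
  rw [← sub_eq_zero]
  set u := s - t with hu
  have hzero : ∀ a b, pairCoeff A a b u = 0 := fun a b => by rw [hu, map_sub, h, sub_self]
  -- expand `u` relative to a basis of the second factor
  let B := Module.Basis.ofVectorSpace ℝ A
  obtain ⟨c, hc⟩ := TensorProduct.eq_repr_basis_right B u
  have hlin : ∀ a : ℕ →₀ ℕ,
      ∑ i ∈ c.support, MvPowerSeries.coeff a (c i : MvPowerSeries ℕ ℝ) • B i = 0 := by
    intro a
    refine Subtype.ext (MvPowerSeries.ext fun b => ?_)
    have := hzero a b
    rw [← hc, Finsupp.sum, map_sum] at this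
    simpa [pairCoeff_tmul] using this
  have hci : c = 0 := by
    ext i a
    by_contra hne
    have hi : i ∈ c.support := by
      rw [Finsupp.mem_support_iff]
      rintro h0
      simp [h0] at hne
    exact hne (linearIndependent_iff'.1 B.linearIndependent _ _ (hlin a) i hi)
  rw [← hc, hci, Finsupp.sum_zero_index]

theorem pairCoeff_mul (a b : ℕ →₀ ℕ) (s t : A ⊗[ℝ] A) :
    pairCoeff A a b (s * t) = ∑ p ∈ antidiagonal a, ∑ q ∈ antidiagonal b,
      pairCoeff A p.1 q.1 s * pairCoeff A p.2 q.2 t := by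
  induction s using TensorProduct.induction_on with
  | zero => simp
  | add s₁ s₂ h₁ h₂ => simp only [add_mul, map_add, h₁, h₂, Finset.sum_add_distrib]
  | tmul f g =>
    induction t using TensorProduct.induction_on with
    | zero => simp
    | add t₁ t₂ h₁ h₂ => simp only [mul_add, map_add, h₁, h₂, Finset.sum_add_distrib]
    | tmul f' g' =>
      simp only [Algebra.TensorProduct.tmul_mul_tmul, pairCoeff_tmul, MulMemClass.coe_mul,
        MvPowerSeries.coeff_mul, Finset.sum_mul_sum]
      refine Finset.sum_congr rfl fun p _ => Finset.sum_congr rfl fun q _ => ?_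
      ring

/-- The element `t` of `A ⊗ A` represents `f(x₁, x₂, …, y₁, y₂, …)`. -/
def IsCoproductAt (f : MvPowerSeries ℕ ℝ) (t : A ⊗[ℝ] A) : Prop :=
  ∀ (N : ℕ) (a b : ℕ →₀ ℕ), (∀ i ∈ a.support, i < N) →
    pairCoeff A a b t = MvPowerSeries.coeff (a + b.mapDomain (fun i => i + N)) f

theorem IsCoproductAt.unique {f : MvPowerSeries ℕ ℝ} {s t : A ⊗[ℝ] A} (hs : IsCoproductAt f s)
    (ht : IsCoproductAt f t) : s = t := by
  refine eq_of_pairCoeff_eq fun a b => ?_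
  have hN : ∀ i ∈ a.support, i < a.support.sup id + 1 := fun i hi =>
    Nat.lt_succ_of_le (Finset.le_sup (f := id) hi)
  rw [hs _ a b hN, ht _ a b hN]

theorem IsCoproductAt.add {f g : MvPowerSeries ℕ ℝ} {s t : A ⊗[ℝ] A} (hs : IsCoproductAt f s)
    (ht : IsCoproductAt g t) : IsCoproductAt (f + g) (s + t) := by
  intro N a b ha
  rw [map_add, map_add, hs N a b ha, ht N a b ha]

/-- The factorizations of `x^a y^b` are the products of those of `x^a` and of `y^b`. -/
theorem sum_antidiagonal_add_mapDomain {N : ℕ} {a b : ℕ →₀ ℕ} (ha : ∀ i ∈ a.support, i < N)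
    (F : (ℕ →₀ ℕ) × (ℕ →₀ ℕ) → ℝ) :
    ∑ r ∈ antidiagonal (a + b.mapDomain (· + N)), F r =
      ∑ p ∈ antidiagonal a, ∑ q ∈ antidiagonal b,
        F (p.1 + q.1.mapDomain (· + N), p.2 + q.2.mapDomain (· + N)) := by
  classical
  rw [← Finset.sum_product']
  have hsupp : ∀ {p q : ℕ →₀ ℕ}, p + q = a → (∀ i ∈ p.support, i < N) ∧ ∀ i ∈ q.support, i < N := by
    rintro p q rfl
    refine ⟨fun i hi => ha i ?_, fun i hi => ha i ?_⟩ <;>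
    · rw [Finsupp.mem_support_iff] at hi ⊢
      rw [Finsupp.add_apply]
      omega
  symm
  refine Finset.sum_bij (fun x _ => (x.1.1 + x.2.1.mapDomain (· + N),
    x.1.2 + x.2.2.mapDomain (· + N))) ?_ ?_ ?_ fun _ _ => rfl
  · rintro ⟨⟨p₁, p₂⟩, q₁, q₂⟩ hx
    rw [Finset.mem_product, mem_antidiagonal, mem_antidiagonal] at hx
    obtain ⟨hp, hq⟩ := hx
    dsimp only at hp hq ⊢
    rw [mem_antidiagonal, ← hp, ← hq, Finsupp.mapDomain_add, add_add_add_comm]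
  · rintro ⟨⟨p₁, p₂⟩, q₁, q₂⟩ hx ⟨⟨p₁', p₂'⟩, q₁', q₂'⟩ hx' heq
    rw [Finset.mem_product, mem_antidiagonal, mem_antidiagonal] at hx hx'
    obtain ⟨h₁, h₂⟩ := Prod.mk.inj heq
    obtain ⟨rfl, rfl⟩ := add_mapDomain_inj (hsupp hx.1).1 (hsupp hx'.1).1 h₁
    obtain ⟨rfl, rfl⟩ := add_mapDomain_inj (hsupp hx.1).2 (hsupp hx'.1).2 h₂
    rfl
  · rintro ⟨r₁, r₂⟩ hr
    rw [mem_antidiagonal] at hr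
    dsimp only at hr
    have hdec : ∀ r : ℕ →₀ ℕ, r = r.filter (· < N) +
        (r.comapDomain (· + N) (add_left_injective N).injOn).mapDomain (· + N) := by
      intro r
      ext i
      rw [Finsupp.add_apply]
      by_cases hi : i < N
      · rw [Finsupp.filter_apply_pos (· < N) _ hi, Finsupp.mapDomain_of_notMem_range, add_zero]
        rintro ⟨j, rfl⟩
        simp at hi
      · rw [Finsupp.filter_apply_neg (· < N) _ hi, zero_add]
        obtain ⟨j, rfl⟩ : ∃ j, i = j + N := ⟨i - N, by omega⟩
        rw [Finsupp.mapDomain_apply (add_left_injective N), Finsupp.comapDomain_apply]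
    have hlow : ∀ r : ℕ →₀ ℕ, ∀ i ∈ (r.filter (· < N)).support, i < N := by
      intro r i hi
      rw [Finsupp.support_filter, Finset.mem_filter] at hi
      exact hi.2
    have hsum : (r₁.filter (· < N) + r₂.filter (· < N)) +
        (r₁.comapDomain (· + N) (add_left_injective N).injOn +
          r₂.comapDomain (· + N) (add_left_injective N).injOn).mapDomain (· + N) =
        a + b.mapDomain (· + N) := by
      rw [← hr, Finsupp.mapDomain_add]
      conv_rhs => rw [hdec r₁, hdec r₂]
      exact add_add_add_comm _ _ _ _
    obtain ⟨e₁, e₂⟩ := add_mapDomain_inj (fun i hi => by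
      rcases Finset.mem_union.1 (Finsupp.support_add hi) with hi | hi
      · exact hlow _ i hi
      · exact hlow _ i hi) ha hsum
    refine ⟨((r₁.filter (· < N), r₂.filter (· < N)),
      (r₁.comapDomain (· + N) (add_left_injective N).injOn,
        r₂.comapDomain (· + N) (add_left_injective N).injOn)), ?_, ?_⟩
    · rw [Finset.mem_product, mem_antidiagonal, mem_antidiagonal]
      exact ⟨e₁, e₂⟩
    · exact Prod.ext (hdec r₁).symm (hdec r₂).symm

theorem IsCoproductAt.mul {f g : MvPowerSeries ℕ ℝ} {s t : A ⊗[ℝ] A} (hs : IsCoproductAt f s)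
    (ht : IsCoproductAt g t) : IsCoproductAt (f * g) (s * t) := by
  classical
  intro N a b ha
  rw [pairCoeff_mul, MvPowerSeries.coeff_mul, sum_antidiagonal_add_mapDomain ha]
  refine Finset.sum_congr rfl fun p hp => Finset.sum_congr rfl fun q _ => ?_
  rw [mem_antidiagonal] at hp
  have h₁ : ∀ i ∈ p.1.support, i < N := by
    intro i hi
    refine ha i ?_
    rw [Finsupp.mem_support_iff] at hi ⊢
    rw [← hp, Finsupp.add_apply]
    omega
  have h₂ : ∀ i ∈ p.2.support, i < N := by
    intro i hi
    refine ha i ?_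
    rw [Finsupp.mem_support_iff] at hi ⊢
    rw [← hp, Finsupp.add_apply]
    omega
  rw [hs N _ _ h₁, ht N _ _ h₂]

theorem isCoproductAt_algebraMap (r : ℝ) :
    IsCoproductAt (algebraMap ℝ (MvPowerSeries ℕ ℝ) r) (algebraMap ℝ (A ⊗[ℝ] A) r) := by
  classical
  intro N a b ha
  rw [Algebra.TensorProduct.algebraMap_apply, pairCoeff_tmul]
  simp only [Subalgebra.coe_algebraMap, Subalgebra.coe_one, MvPowerSeries.algebraMap_apply,
    Algebra.algebraMap_self, RingHom.id_apply, MvPowerSeries.coeff_C, MvPowerSeries.coeff_one]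
  have hb : b.mapDomain (· + N) = 0 ↔ b = 0 := by
    rw [← Finsupp.mapDomain_zero (f := fun i : ℕ => i + N)]
    exact (Finsupp.mapDomain_injective (add_left_injective N)).eq_iff
  simp only [add_eq_zero, hb]
  split_ifs <;> simp_all

theorem exists_isCoproductAt_of_mem_adjoin {S : Set (MvPowerSeries ℕ ℝ)}
    (hS : ∀ f ∈ S, ∃ t : A ⊗[ℝ] A, IsCoproductAt f t) {f : MvPowerSeries ℕ ℝ}
    (hf : f ∈ Algebra.adjoin ℝ S) : ∃ t : A ⊗[ℝ] A, IsCoproductAt f t := by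
  induction hf using Algebra.adjoin_induction with
  | mem f hf => exact hS f hf
  | algebraMap r => exact ⟨_, isCoproductAt_algebraMap r⟩
  | add f g _ _ hf hg =>
    obtain ⟨s, hs⟩ := hf
    obtain ⟨t, ht⟩ := hg
    exact ⟨_, hs.add ht⟩
  | mul f g _ _ hf hg =>
    obtain ⟨s, hs⟩ := hf
    obtain ⟨t, ht⟩ := hg
    exact ⟨_, hs.mul ht⟩

/-- As `p ⊗ q ↦ p(x) q(y)` is injective, elementwise coproducts assemble to an algebra
morphism. -/
theorem existsUnique_isCoproduct
    (hA : ∀ f : A, ∃ t : A ⊗[ℝ] A, IsCoproductAt (f : MvPowerSeries ℕ ℝ) t) :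
    ∃! Δ : A →ₐ[ℝ] A ⊗[ℝ] A, IsCoproduct A Δ := by
  choose δ hδ using hA
  have hadd : ∀ f g, δ (f + g) = δ f + δ g := fun f g => (hδ _).unique ((hδ f).add (hδ g))
  have hmul : ∀ f g, δ (f * g) = δ f * δ g := fun f g => (hδ _).unique ((hδ f).mul (hδ g))
  have hmap : ∀ r, δ (algebraMap ℝ A r) = algebraMap ℝ (A ⊗[ℝ] A) r := fun r =>
    (hδ _).unique (isCoproductAt_algebraMap r)
  refine ⟨{ toFun := δ
            map_one' := by rw [← map_one (algebraMap ℝ A), hmap, map_one]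
            map_mul' := hmul
            map_zero' := by rw [← map_zero (algebraMap ℝ A), hmap, map_zero]
            map_add' := hadd
            commutes' := hmap }, fun f => hδ f, fun Δ hΔ => ?_⟩
  exact AlgHom.ext fun f => IsCoproductAt.unique (hΔ f) (hδ f)

end Coproduct

/-! ### Unions of specializations -/

section Union

variable {A : Subalgebra ℝ (MvPowerSeries ℕ ℝ)}

/-- The linear map `p ⊗ q ↦ ρ(p) q`. -/
def contract (ρ : A →ₐ[ℝ] ℝ) : A ⊗[ℝ] A →ₗ[ℝ] A :=
  TensorProduct.lid ℝ A ∘ₗ TensorProduct.map ρ.toLinearMap LinearMap.id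

theorem contract_tmul (ρ : A →ₐ[ℝ] ℝ) (f g : A) : contract ρ (f ⊗ₜ[ℝ] g) = ρ f • g := by
  simp [contract]

theorem union_apply (ρ φ : A →ₐ[ℝ] ℝ) (f : A) :
    union ρ φ f = φ (contract ρ (coproduct A f)) := by
  change Algebra.TensorProduct.lmul' ℝ (S := ℝ) (Algebra.TensorProduct.map ρ φ (coproduct A f)) = _
  induction coproduct A f using TensorProduct.induction_on with
  | zero => simp
  | add s t hs ht => simp only [map_add, hs, ht]
  | tmul p q => simp [contract_tmul]

theorem coeff_contract_evalOne (hA : A ≤ polyOne) (b : ℕ →₀ ℕ) (t : A ⊗[ℝ] A) :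
    (Function.support fun n => pairCoeff A (Finsupp.single 0 n) b t).Finite ∧
      MvPowerSeries.coeff b (contract (evalOne A hA) t : MvPowerSeries ℕ ℝ) =
        ∑ᶠ n, pairCoeff A (Finsupp.single 0 n) b t := by
  induction t using TensorProduct.induction_on with
  | zero => simp
  | add s t hs ht =>
    simp only [map_add]
    refine ⟨(hs.1.union ht.1).subset (Function.support_add _ _), ?_⟩
    rw [finsum_add_distrib hs.1 ht.1, Subalgebra.coe_add, map_add, hs.2, ht.2]
  | tmul p q =>
    simp only [pairCoeff_tmul, contract_tmul]
    refine ⟨(finite_support_coeffOne (hA p.2)).subset (Function.support_mul_subset_left _ _), ?_⟩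
    rw [← finsum_mul]
    rfl

theorem isCoproduct_coproduct (h : ∃ Δ : A →ₐ[ℝ] A ⊗[ℝ] A, IsCoproduct A Δ) :
    IsCoproduct A (coproduct A) := by
  rw [coproduct, dif_pos h]
  exact h.choose_spec

/-- The specialization `φ⁺` is `φ` composed with the substitution of `1` for the first variable,
and this substitution maps `A` to itself. -/
theorem exists_union_evalOne (hA : A ≤ polyOne) (h : ∃ Δ : A →ₐ[ℝ] A ⊗[ℝ] A, IsCoproduct A Δ)
    (φ : A →ₐ[ℝ] ℝ) (f : A) :
    ∃ g : A, (g : MvPowerSeries ℕ ℝ) = substOne f ∧ union (evalOne A hA) φ f = φ g := by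
  refine ⟨contract (evalOne A hA) (coproduct A f), MvPowerSeries.ext fun b => ?_,
    union_apply _ _ _⟩
  rw [(coeff_contract_evalOne hA b _).2, coeff_substOne]
  refine finsum_congr fun n => isCoproduct_coproduct h f 1 _ b fun i hi => ?_
  have := Finset.mem_singleton.1 (Finsupp.support_single_subset hi)
  omega

end Union

/-! ### The algebras of `GP`- and `GQ`-functions -/

theorem isCoproductAt_tabSeries {A : Subalgebra ℝ (MvPowerSeries ℕ ℝ)} (d : Prop)
    (hA : ∀ l μ, tabSeries d l μ ∈ A) (l μ : StrictPartition) :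
    ∃ t : A ⊗[ℝ] A, IsCoproductAt (tabSeries d l μ) t := by
  by_cases h : μ.Sub l
  · refine ⟨∑ ν ∈ between μ l, ⟨_, hA ν μ⟩ ⊗ₜ ⟨_, hA l ν⟩, fun N a b ha => ?_⟩
    rw [coeff_add_tabSeries d h N a b ha, map_sum]
    exact Finset.sum_congr rfl fun ν _ => pairCoeff_tmul _ _ _ _
  · refine ⟨0, fun N a b _ => ?_⟩
    rw [tabSeries_of_not_sub d h, map_zero, map_zero]

theorem existsUnique_isCoproduct_GammaP :
    ∃! Δ : GammaP →ₐ[ℝ] GammaP ⊗[ℝ] GammaP, IsCoproduct GammaP Δ := by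
  refine existsUnique_isCoproduct fun f => exists_isCoproductAt_of_mem_adjoin ?_ f.2
  rintro _ ⟨l, μ, rfl⟩
  rw [← tabSeries_true]
  refine isCoproductAt_tabSeries True (fun l μ => ?_) l μ
  rw [tabSeries_true]
  exact GPbar_mem l μ

theorem existsUnique_isCoproduct_GammaQ :
    ∃! Δ : GammaQ →ₐ[ℝ] GammaQ ⊗[ℝ] GammaQ, IsCoproduct GammaQ Δ := by
  refine existsUnique_isCoproduct fun f => exists_isCoproductAt_of_mem_adjoin ?_ f.2
  rintro _ ⟨l, μ, rfl⟩
  rw [← tabSeries_false]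
  refine isCoproductAt_tabSeries False (fun l μ => ?_) l μ
  rw [tabSeries_false]
  exact GQbar_mem l μ

theorem substOne_GPbar (l μ : StrictPartition) : substOne (GPbar l μ) = GPbar l.tail μ := by
  rw [← tabSeries_true, substOne_tabSeries, tabSeries_true]

theorem substOne_GQbar (l μ : StrictPartition) : substOne (GQbar l μ) = GQbar l.tail μ := by
  rw [← tabSeries_false, substOne_tabSeries, tabSeries_false]

theorem plusP_gp (φ : GammaP →ₐ[ℝ] ℝ) (l μ : StrictPartition) :
    plusP φ (gp l μ) = φ (gp l.tail μ) := by
  obtain ⟨g, hg, h⟩ := exists_union_evalOne GammaP_le existsUnique_isCoproduct_GammaP.exists φ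
    (gp l μ)
  rw [plusP, oneHatP, h]
  exact congrArg φ (Subtype.ext (hg.trans (substOne_GPbar l μ)))

theorem plusP_eq_of_coe_eq_GQbar (φ : GammaP →ₐ[ℝ] ℝ) (l μ : StrictPartition) (f : GammaP)
    (hf : (f : MvPowerSeries ℕ ℝ) = GQbar l μ) :
    ∃ g : GammaP, (g : MvPowerSeries ℕ ℝ) = GQbar l.tail μ ∧ plusP φ f = φ g := by
  obtain ⟨g, hg, h⟩ := exists_union_evalOne GammaP_le existsUnique_isCoproduct_GammaP.exists φ f
  exact ⟨g, by rw [hg, hf, substOne_GQbar], h⟩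

theorem plusQ_gq (φ : GammaQ →ₐ[ℝ] ℝ) (l μ : StrictPartition) :
    plusQ φ (gq l μ) = φ (gq l.tail μ) := by
  obtain ⟨g, hg, h⟩ := exists_union_evalOne GammaQ_le existsUnique_isCoproduct_GammaQ.exists φ
    (gq l μ)
  rw [plusQ, oneHatQ, h]
  exact congrArg φ (Subtype.ext (hg.trans (substOne_GQbar l μ)))

theorem tail_row (n : ℕ) : (row n).tail = empty :=
  StrictPartition.ext (funext fun i => by simp [tail, row, empty])

theorem SD_empty : empty.SD = ∅ := by
  refine Finset.eq_empty_of_forall_notMem ?_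
  rintro ⟨i, j⟩ h
  rw [mem_SD] at h
  simp only [empty, row, ite_self] at h
  omega

theorem tabSeries_empty (d : Prop) : tabSeries d empty empty = 1 := by
  classical
  have hempty : ∀ T, IsTab d empty empty T ↔ T = fun _ => ∅ := by
    intro T
    constructor
    · intro hT
      exact funext fun b => hT.support b (by simp [SD_empty])
    · rintro rfl
      exact ⟨⟨by simp, by simp, by simp, by simp, by simp, by simp⟩, by simp⟩
  ext m
  change tableauSeries _ _ _ _ m = _
  rw [tableauSeries, if_pos (Sub.refl _), MvPowerSeries.coeff_one]
  simp_rw [hempty, SD_empty, weight, size, SD_empty, Finset.sum_empty]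
  rw [finsum_eq_single _ (fun _ => ∅)]
  · by_cases hm : m = 0
    · simp [hm]
    · simp [hm, Ne.symm hm]
  · intro T hT
    simp [hT]

theorem isPositive_plusP_iff (φ : GammaP →ₐ[ℝ] ℝ) :
    IsPositive setGPbar (plusP φ) ↔ IsPositive setGPbar φ := by
  constructor
  · rintro h f ⟨l, μ, hf⟩
    obtain rfl : f = gp (l.prepend 0).tail μ := Subtype.ext hf
    rw [← plusP_gp]
    exact h _ ⟨_, _, rfl⟩
  · rintro h f ⟨l, μ, hf⟩
    obtain rfl : f = gp l μ := Subtype.ext hf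
    rw [plusP_gp]
    exact h _ ⟨_, _, rfl⟩

theorem isPositive_plusQ_iff (φ : GammaQ →ₐ[ℝ] ℝ) :
    IsPositive setGQbar (plusQ φ) ↔ IsPositive setGQbar φ := by
  constructor
  · rintro h f ⟨l, μ, hf⟩
    obtain rfl : f = gq (l.prepend 0).tail μ := Subtype.ext hf
    rw [← plusQ_gq]
    exact h _ ⟨_, _, rfl⟩
  · rintro h f ⟨l, μ, hf⟩
    obtain rfl : f = gq l μ := Subtype.ext hf
    rw [plusQ_gq]
    exact h _ ⟨_, _, rfl⟩

theorem gp_empty : gp empty empty = 1 :=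
  Subtype.ext ((tabSeries_true _ _).symm.trans (tabSeries_empty True))

theorem gq_empty : gq empty empty = 1 :=
  Subtype.ext ((tabSeries_false _ _).symm.trans (tabSeries_empty False))

end ShiftedK

end

open ShiftedK in
theorem mainTheorem8 :
    -- both algebras carry the coproduct of symmetric functions, so that unions are defined
    (∃! Δ : GammaP →ₐ[ℝ] GammaP ⊗[ℝ] GammaP, IsCoproduct GammaP Δ) ∧
    (∃! Δ : GammaQ →ₐ[ℝ] GammaQ ⊗[ℝ] GammaQ, IsCoproduct GammaQ Δ) ∧
    -- specializations of `GammaP`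
    (∀ φ : GammaP →ₐ[ℝ] ℝ,
      (∀ l μ : StrictPartition, plusP φ (gp l μ) = φ (gp l.tail μ)) ∧
      (∀ n : ℕ, 0 < n → plusP φ (gp (StrictPartition.row n) StrictPartition.empty) = 1) ∧
      (IsPositive setGPbar (plusP φ) ↔ IsPositive setGPbar φ) ∧
      -- the same identities for those `GQ`-functions that are given as elements of `GammaP`
      (∀ (l μ : StrictPartition) (f : GammaP), (f : MvPowerSeries ℕ ℝ) = GQbar l μ →
        ∃ g : GammaP, (g : MvPowerSeries ℕ ℝ) = GQbar l.tail μ ∧ plusP φ f = φ g) ∧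
      (∀ (n : ℕ) (f : GammaP), 0 < n →
        (f : MvPowerSeries ℕ ℝ) = GQbar (StrictPartition.row n) StrictPartition.empty →
        plusP φ f = 1)) ∧
    -- specializations of `GammaQ`
    (∀ φ : GammaQ →ₐ[ℝ] ℝ,
      (∀ l μ : StrictPartition, plusQ φ (gq l μ) = φ (gq l.tail μ)) ∧
      (∀ n : ℕ, 0 < n → plusQ φ (gq (StrictPartition.row n) StrictPartition.empty) = 1) ∧
      (IsPositive setGQbar (plusQ φ) ↔ IsPositive setGQbar φ)) := by
  refine ⟨existsUnique_isCoproduct_GammaP, existsUnique_isCoproduct_GammaQ,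
    fun φ => ⟨plusP_gp φ, fun n _ => ?_, isPositive_plusP_iff φ, plusP_eq_of_coe_eq_GQbar φ,
      fun n f _ hf => ?_⟩,
    fun φ => ⟨plusQ_gq φ, fun n _ => ?_, isPositive_plusQ_iff φ⟩⟩
  · rw [plusP_gp, tail_row, gp_empty, map_one]
  · obtain ⟨g, hg, h⟩ := plusP_eq_of_coe_eq_GQbar φ _ _ f hf
    rw [tail_row, ← tabSeries_false, tabSeries_empty] at hg
    obtain rfl : g = 1 := Subtype.ext hg
    rw [h, map_one]
  · rw [plusQ_gq, tail_row, gq_empty, map_one]
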